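/- A prelog ring $(A,M)$ is a commutative ring $A$ with a commutative monoid $M$ and a homomorphism of monoids $\alpha\colon M\to (A,\cdot)$; homomorphisms are pairs of compatible homomorphisms. Write $M^{gp}$ for the group completion of $M$. Let $(C,Q)\to(B,N)$ be a homomorphism of prelog rings with $C\to B$ and $Q\to N$ surjective, and let $(C,Q)\to(R,P)\to(B,N)$ be a factorization of it (with $(C,Q)$ and $(B,N)$ seen as constant) through a simplicial prelog ring $(R,P)$ such that: * $(C,Q)\to(R,P)$ is a free cofibration: there are subsets $Y_n\subset P_n$ and $X_n\subset R_n$, stable under the degeneracies, with $P_n=Q\oplus\mathbb N^{Y_n}$ and $R_n=C[X_n\sqcup Y_n]$ (where $y \in Y_n$ is sent to $\alpha(y)\in R_n$); * $(R,P)\to(B,N)$ is a trivial fibration: the maps of simplicial sets $R\to B$ and $P\to N$ are trivial Kan fibrations; * $R_0=C$ and $P_0=Q$. Let $I=\ker(\pi\colon R\otimes_CB\to B)$, $J=\ker(\mathbb Z[P]\otimes_{\mathbb Z[Q]}\mathbb Z[N]\to\mathbb Z[N])$, $T=\ker((P\oplus_QN)^{gp}\to N^{gp})$ and $U=(R\otimes_CB)\otimes_{\mathbb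 Z[P]\otimes_{\mathbb Z[Q]}\mathbb Z[N]}J$. Let $\alpha\colon U\to I$ be the map that sends $a\otimes j$ to $a$ times the image of $j$ in $R\otimes_C B$. Let $\beta\colon U\to B\otimes_{\mathbb Z}T$ be the map $a\otimes j\mapsto\pi(a)\,v(j)$, where $v\colon J\to B\otimes_{\mathbb Z}T$ is the additive map that sends $p-p'$, for $p,p'\in P_n\oplus_QN$ with the same image $m$ in $N$, to $m\otimes p/p'$ (here $\mathbb Z[P]\otimes_{\mathbb Z[Q]}\mathbb Z[N]=\mathbb Z[P\oplus_QN]$, and $m$ acts through its image in $B$). Let $D^1=D^1_{(B,N)|(C,Q)}$ be the pushout of $\alpha$ and $\beta$. For a simplicial module, $H_n$ denotes the homology of the associated chain complex. Then there is a long exact sequence of $B$-modules $$\cdots\to H_n(U)\to\operatorname{Tor}_n^C(B,B)\oplus W_n\to H_n(D^1)\to H_{n-1}(U)\to\cdots\to H_1(U)\to\operatorname{Tor}_1^C(B,B)\oplus W_1\to H_1(D^1)\to0,$$ where $$W_1=\ker(Q^{gp}\to N^{gp})\otimes_{\mathbb Z}B,\qquad W_2=\operatorname{Tor}_1^{\mathbb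 Z}(\ker(Q^{gp}\to N^{gp}),B),\qquad W_n=0\ \text{ for } n\neq1,2.$$ Moreover there are isomorphisms $H_n(I)\cong\operatorname{Tor}_n^C(B,B)$ and $H_n(B\otimes_{\mathbb Z}T)\cong W_n$ for $n\ge1$ such that, under them, the first map is $(H_n(\alpha),H_n(\beta))$ and the second map is the difference of the maps induced by $I\to D^1$ and $B\otimes_{\mathbb Z}T\to D^1$. -/

import Mathlib

open CategoryTheory CategoryTheory.Limits Simplicial TensorProduct

universe u w

/-! ### Prelog rings -/

/-- A prelog ring `(A, M, α)`: a commutative ring `A`, a commutative monoid `M` and a homomorphism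
of monoids `α : M → (A, ·)`. -/
structure PrelogRing : Type (u + 1) where
  ring : Type u
  mon : Type u
  [commRing : CommRing ring]
  [commMonoid : CommMonoid mon]
  α : mon →* ring

namespace PrelogRing

attribute [instance] PrelogRing.commRing PrelogRing.commMonoid

/-- Homomorphisms of prelog rings. -/
@[ext]
structure Hom (X Y : PrelogRing.{u}) : Type u where
  ring : X.ring →+* Y.ring
  mon : X.mon →* Y.mon
  comm : ∀ m, Y.α (mon m) = ring (X.α m)

instance : Category PrelogRing.{u} where
  Hom := Hom
  id X := ⟨RingHom.id _, MonoidHom.id _, fun _ => rfl⟩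
  comp f g := ⟨g.ring.comp f.ring, g.mon.comp f.mon, fun m => by simp [f.comm, g.comm]⟩

@[ext]
theorem hom_ext {X Y : PrelogRing.{u}} {f g : X ⟶ Y} (h₁ : f.ring = g.ring) (h₂ : f.mon = g.mon) :
    f = g := Hom.ext h₁ h₂

@[simp] theorem id_ring (X : PrelogRing.{u}) : Hom.ring (𝟙 X) = RingHom.id X.ring := rfl
@[simp] theorem id_mon (X : PrelogRing.{u}) : Hom.mon (𝟙 X) = MonoidHom.id X.mon := rfl
@[simp] theorem comp_ring {X Y Z : PrelogRing.{u}} (f : X ⟶ Y) (g : Y ⟶ Z) :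
    (f ≫ g).ring = g.ring.comp f.ring := rfl
@[simp] theorem comp_mon {X Y Z : PrelogRing.{u}} (f : X ⟶ Y) (g : Y ⟶ Z) :
    (f ≫ g).mon = g.mon.comp f.mon := rfl

/-- The underlying set of the ring of a prelog ring. -/
def forgetRing : PrelogRing.{u} ⥤ Type u where
  obj X := X.ring
  map f := ↾f.ring

/-- The underlying set of the monoid of a prelog ring. -/
def forgetMon : PrelogRing.{u} ⥤ Type u where
  obj X := X.mon
  map f := ↾f.mon

end PrelogRing

/-! ### Free cofibrations and trivial fibrations of simplicial prelog rings -/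

/-- A homomorphism `f : X → Y` of simplicial prelog rings is a *free cofibration* if there are
subsets `V n` of the monoid and `Z n` of the ring of `Yₙ`, stable under the degeneracies, such that
the monoid of `Yₙ` is the direct sum of the monoid of `Xₙ` and of the free commutative monoid on
`V n`, and the ring of `Yₙ` is the polynomial ring over the ring of `Xₙ` on the disjoint union of
`V n` and `Z n` (where the elements of `V n` are seen in the ring by means of `α`). -/
def IsFreeCofibration {X Y : SimplicialObject PrelogRing.{u}} (f : X ⟶ Y) : Prop :=
  ∃ (V : ∀ n : ℕ, Set (Y _⦋n⦌).mon) (Z : ∀ n : ℕ, Set (Y _⦋n⦌).ring),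
    (∀ n : ℕ, Function.Bijective fun a : (X _⦋n⦌).mon × (V n →₀ ℕ) =>
      (f.app (Opposite.op ⦋n⦌)).mon a.1 * a.2.prod fun v k => (v : (Y _⦋n⦌).mon) ^ k) ∧
    (∀ n : ℕ, Function.Bijective (MvPolynomial.eval₂Hom (f.app (Opposite.op ⦋n⦌)).ring
      (Sum.elim (fun v : V n => (Y _⦋n⦌).α v) (fun z : Z n => (z : (Y _⦋n⦌).ring))))) ∧
    (∀ (n : ℕ) (j : Fin (n + 1)), ∀ v ∈ V n, (Y.σ j).mon v ∈ V (n + 1)) ∧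
    (∀ (n : ℕ) (j : Fin (n + 1)), ∀ z ∈ Z n, (Y.σ j).ring z ∈ Z (n + 1))

/-- A homomorphism of simplicial prelog rings is a *trivial fibration* if the underlying maps of
simplicial sets, on the rings and on the monoids, are trivial (Kan) fibrations, that is, have the
right lifting property with respect to the inclusions `∂Δ[n] ⊆ Δ[n]`. -/
def IsTrivialFibration {X Y : SimplicialObject PrelogRing.{u}} (f : X ⟶ Y) : Prop :=
  SSet.modelCategoryQuillen.I.{u}.rlp (Functor.whiskerRight f PrelogRing.forgetRing) ∧
  SSet.modelCategoryQuillen.I.{u}.rlp (Functor.whiskerRight f PrelogRing.forgetMon)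

/-! ### Pushouts of commutative rings and of commutative monoids -/

/-- The ring `R ⊗_C B`, for homomorphisms of commutative rings `f : C → R` and `g : C → B`. -/
def RingPushout {C R B : Type u} [CommRing C] [CommRing R] [CommRing B]
    (f : C →+* R) (g : C →+* B) : Type u :=
  letI := f.toAlgebra
  letI := g.toAlgebra
  R ⊗[C] B

namespace RingPushout

variable {C R B : Type u} [CommRing C] [CommRing R] [CommRing B] (f : C →+* R) (g : C →+* B)

noncomputable instance : CommRing (RingPushout f g) :=
  letI := f.toAlgebra
  letI := g.toAlgebra
  (inferInstance : CommRing (R ⊗[C] B))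

/-- `r ↦ r ⊗ 1` -/
noncomputable def inl : R →+* RingPushout f g :=
  letI := f.toAlgebra
  letI := g.toAlgebra
  (Algebra.TensorProduct.includeLeft : R →ₐ[C] R ⊗[C] B).toRingHom

/-- `b ↦ 1 ⊗ b` -/
noncomputable def inr : B →+* RingPushout f g :=
  letI := f.toAlgebra
  letI := g.toAlgebra
  (Algebra.TensorProduct.includeRight : B →ₐ[C] R ⊗[C] B).toRingHom

theorem condition : (inl f g).comp f = (inr f g).comp g := by
  let := f.toAlgebra
  let := g.toAlgebra
  ext c
  exact ((Algebra.TensorProduct.includeLeft : R →ₐ[C] R ⊗[C] B).commutes c).trans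
    ((Algebra.TensorProduct.includeRight : B →ₐ[C] R ⊗[C] B).commutes c).symm

variable {f g} {D : Type u} [CommRing D]

/-- `r ⊗ b ↦ u r * v b` -/
noncomputable def desc (u : R →+* D) (v : B →+* D) (h : u.comp f = v.comp g) :
    RingPushout f g →+* D :=
  letI := f.toAlgebra
  letI := g.toAlgebra
  letI := (u.comp f).toAlgebra
  (Algebra.TensorProduct.productMap (R := C) (S := D)
    { u with commutes' := fun _ => rfl }
    { v with commutes' := fun c => (RingHom.congr_fun h c).symm }).toRingHom

@[simp] theorem desc_inl (u : R →+* D) (v : B →+* D) (h : u.comp f = v.comp g) (r : R) :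
    desc u v h (inl f g r) = u r := by
  let := f.toAlgebra
  let := g.toAlgebra
  let := (u.comp f).toAlgebra
  exact Algebra.TensorProduct.productMap_left_apply _ _ r

@[simp] theorem desc_inr (u : R →+* D) (v : B →+* D) (h : u.comp f = v.comp g) (b : B) :
    desc u v h (inr f g b) = v b := by
  let := f.toAlgebra
  let := g.toAlgebra
  let := (u.comp f).toAlgebra
  exact Algebra.TensorProduct.productMap_right_apply _ _ b

theorem hom_ext {k l : RingPushout f g →+* D} (h₁ : ∀ r, k (inl f g r) = l (inl f g r))
    (h₂ : ∀ b, k (inr f g b) = l (inr f g b)) : k = l := by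
  let := f.toAlgebra
  let := g.toAlgebra
  ext x
  induction x using TensorProduct.induction_on with
  | zero => exact (map_zero k).trans (map_zero l).symm
  | add x y hx hy => exact (map_add k x y).trans ((congrArg₂ _ hx hy).trans (map_add l x y).symm)
  | tmul r b =>
    have e : (r ⊗ₜ[C] b : RingPushout f g) = inl f g r * inr f g b :=
      ((Algebra.TensorProduct.tmul_mul_tmul r 1 1 b).trans (by simp)).symm
    rw [e, map_mul, map_mul, h₁, h₂]

end RingPushout

/-- The amalgamated sum `P ⊕_Q N` of commutative monoids (written multiplicatively), for
homomorphisms `f : Q → P` and `g : Q → N`. -/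
def MonPushout {Q P N : Type u} [CommMonoid Q] [CommMonoid P] [CommMonoid N]
    (f : Q →* P) (g : Q →* N) : Type u :=
  (conGen fun x y : P × N => ∃ q, x = (f q, 1) ∧ y = (1, g q)).Quotient

namespace MonPushout

variable {Q P N : Type u} [CommMonoid Q] [CommMonoid P] [CommMonoid N] (f : Q →* P) (g : Q →* N)

instance : CommMonoid (MonPushout f g) := inferInstanceAs (CommMonoid (Con.Quotient _))

/-- The quotient map `P × N → P ⊕_Q N`. -/
def mk : P × N →* MonPushout f g := Con.mk' _

/-- The canonical homomorphism `P → P ⊕_Q N`. -/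
def inl : P →* MonPushout f g := (mk f g).comp (MonoidHom.inl P N)

/-- The canonical homomorphism `N → P ⊕_Q N`. -/
def inr : N →* MonPushout f g := (mk f g).comp (MonoidHom.inr P N)

theorem condition : (inl f g).comp f = (inr f g).comp g := by
  ext q
  exact (Con.eq _).2 (ConGen.Rel.of _ _ ⟨q, rfl, rfl⟩)

variable {f g} {D : Type u} [CommMonoid D]

/-- The homomorphism `P ⊕_Q N → D` given by homomorphisms on `P` and on `N` that agree on `Q`. -/
def desc (u : P →* D) (v : N →* D) (h : u.comp f = v.comp g) : MonPushout f g →* D :=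
  Con.lift _ (u.coprod v) (by
    refine Con.conGen_le.2 ?_
    rintro _ _ ⟨q, rfl, rfl⟩
    simpa [Con.ker_rel] using DFunLike.congr_fun h q)

@[simp] theorem desc_inl (u : P →* D) (v : N →* D) (h : u.comp f = v.comp g) (p : P) :
    desc u v h (inl f g p) = u p := by
  change (u.coprod v) (p, 1) = u p
  simp

@[simp] theorem desc_inr (u : P →* D) (v : N →* D) (h : u.comp f = v.comp g) (n : N) :
    desc u v h (inr f g n) = v n := by
  change (u.coprod v) (1, n) = v n
  simp

theorem hom_ext {k l : MonPushout f g →* D} (h₁ : ∀ p, k (inl f g p) = l (inl f g p))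
    (h₂ : ∀ n, k (inr f g n) = l (inr f g n)) : k = l := by
  refine Con.hom_ext (MonoidHom.ext fun x => ?_)
  have e : mk f g x = inl f g x.1 * inr f g x.2 := by
    change mk f g x = mk f g (x.1, 1) * mk f g (1, x.2)
    rw [← map_mul]
    simp
  change k (mk f g x) = l (mk f g x)
  rw [e, map_mul, map_mul, h₁, h₂]

end MonPushout

/-! ### Group completion -/

/-- The homomorphism `M^gp → N^gp` induced by a homomorphism of commutative monoids `M → N`. -/
noncomputable def gpMap {M N : Type u} [CommMonoid M] [CommMonoid N] (f : M →* N) :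
    Algebra.GrothendieckGroup M →* Algebra.GrothendieckGroup N :=
  Algebra.GrothendieckGroup.lift (Algebra.GrothendieckGroup.of.comp f)

@[simp] theorem gpMap_of {M N : Type u} [CommMonoid M] [CommMonoid N] (f : M →* N) (m : M) :
    gpMap f (Algebra.GrothendieckGroup.of m) = Algebra.GrothendieckGroup.of (f m) :=
  DFunLike.congr_fun
    (Algebra.GrothendieckGroup.lift.symm_apply_apply (Algebra.GrothendieckGroup.of.comp f)) m

theorem gp_hom_ext {M G : Type u} [CommMonoid M] [CommGroup G]
    {k l : Algebra.GrothendieckGroup M →* G}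
    (h : ∀ m, k (Algebra.GrothendieckGroup.of m) = l (Algebra.GrothendieckGroup.of m)) : k = l :=
  Algebra.GrothendieckGroup.lift.symm.injective (MonoidHom.ext h)

theorem gpMap_comp {M N L : Type u} [CommMonoid M] [CommMonoid N] [CommMonoid L]
    (f : M →* N) (g : N →* L) : gpMap (g.comp f) = (gpMap g).comp (gpMap f) :=
  gp_hom_ext fun m => by
    rw [MonoidHom.comp_apply, gpMap_of, gpMap_of, gpMap_of, MonoidHom.comp_apply]

theorem gpMap_id {M : Type u} [CommMonoid M] :
    gpMap (MonoidHom.id M) = MonoidHom.id (Algebra.GrothendieckGroup M) :=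
  gp_hom_ext fun m => by
    rw [gpMap_of, MonoidHom.id_apply, MonoidHom.id_apply]

/-- The group `ker (M^gp → N^gp)`. -/
abbrev GpKer {M N : Type u} [CommMonoid M] [CommMonoid N] (f : M →* N) : Type u :=
  (gpMap f).ker

/-! ### The homomorphism `ker (ℤ[M] → ℤ[N]) → B ⊗ ker (M^gp → N^gp)` -/

/-- The ring homomorphism `ℤ[M] → R` that extends a homomorphism of monoids `M → (R, ·)`. -/
noncomputable def monoidRingLift {M R : Type u} [CommMonoid M] [CommRing R] (f : M →* R) :
    MonoidAlgebra ℤ M →+* R :=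
  (MonoidAlgebra.lift ℤ R M f).toRingHom

@[simp] theorem monoidRingLift_single {M R : Type u} [CommMonoid M] [CommRing R] (f : M →* R)
    (m : M) (k : ℤ) : monoidRingLift f (MonoidAlgebra.single m k) = k • f m :=
  MonoidAlgebra.lift_single f m k

section LogSymbol

variable {M N B : Type u} [CommMonoid M] [CommMonoid N] [CommRing B]
  (pr : M →* N) (s : N →* M) (hs : ∀ n, pr (s n) = n) (b : N →* B)

/-- For a section `s` of `pr : M → N`, the homomorphism `M → ker (M^gp → N^gp)` given by
`m ↦ m / s (pr m)`. -/
noncomputable def fibreRatio : M →* GpKer pr :=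
  MonoidHom.codRestrict
    ((Algebra.GrothendieckGroup.of : M →* _) / (Algebra.GrothendieckGroup.of.comp (s.comp pr)))
    (gpMap pr).ker (fun m => by
      rw [MonoidHom.mem_ker, MonoidHom.div_apply, map_div, MonoidHom.comp_apply, gpMap_of, gpMap_of,
        MonoidHom.comp_apply, hs, div_self'])

theorem fibreRatio_coe (m : M) :
    (fibreRatio pr s hs m : Algebra.GrothendieckGroup M) =
      Algebra.GrothendieckGroup.of m / Algebra.GrothendieckGroup.of (s (pr m)) := rfl

/-- The additive map `ℤ[M] → B ⊗ ker (M^gp → N^gp)` given by `m ↦ b (pr m) ⊗ (m / s (pr m))`. Its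
restriction to `ker (ℤ[M] → ℤ[N])` is the map `m - m' ↦ b (pr m') ⊗ (m / m')` (for
`pr m = pr m'`), see `logSymbol_sub`, and does not depend on the section `s`. -/
noncomputable def logSymbol : MonoidAlgebra ℤ M →+ B ⊗[ℤ] Additive (GpKer pr) :=
  (Finsupp.liftAddHom fun m => (zmultiplesHom (B ⊗[ℤ] Additive (GpKer pr)))
    (b (pr m) ⊗ₜ[ℤ] Additive.ofMul (fibreRatio pr s hs m))).comp
    (MonoidAlgebra.coeffAddEquiv : MonoidAlgebra ℤ M ≃+ (M →₀ ℤ)).toAddMonoidHom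

@[simp] theorem logSymbol_single (m : M) (k : ℤ) :
    logSymbol pr s hs b (MonoidAlgebra.single m k) =
      k • (b (pr m) ⊗ₜ[ℤ] Additive.ofMul (fibreRatio pr s hs m)) := by
  simp [logSymbol]

theorem logSymbol_sub (m m' : M) (h : pr m = pr m') :
    logSymbol pr s hs b (MonoidAlgebra.single m 1 - MonoidAlgebra.single m' 1) =
      b (pr m') ⊗ₜ[ℤ] Additive.ofMul
        (⟨Algebra.GrothendieckGroup.of m / Algebra.GrothendieckGroup.of m', by
          rw [MonoidHom.mem_ker, map_div, gpMap_of, gpMap_of, h, div_self']⟩ : GpKer pr) := by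
  have e : b (pr m) = b (pr m') := congrArg b h
  rw [map_sub, logSymbol_single, logSymbol_single, one_smul, one_smul, e, ← TensorProduct.tmul_sub,
    ← ofMul_div]
  congr 2
  ext
  simp [fibreRatio, h]

theorem logSymbol_mul (x y : MonoidAlgebra ℤ M) :
    logSymbol pr s hs b (x * y) =
      monoidRingLift (b.comp pr) x • logSymbol pr s hs b y +
        monoidRingLift (b.comp pr) y • logSymbol pr s hs b x := by
  induction x using MonoidAlgebra.induction_linear with
  | zero => simp
  | add x x' hx hx' => simp only [add_mul, map_add, hx, hx', add_smul, smul_add]; abel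
  | single m k =>
    induction y using MonoidAlgebra.induction_linear with
    | zero => simp
    | add y y' hy hy' => simp only [mul_add, map_add, hy, hy', add_smul, smul_add]; abel
    | single m' k' =>
      simp only [MonoidAlgebra.single_mul_single, logSymbol_single, monoidRingLift_single, map_mul,
        ofMul_mul, TensorProduct.tmul_add, smul_add, MonoidHom.comp_apply, smul_assoc,
        TensorProduct.smul_tmul', smul_eq_mul, mul_smul_comm, mul_smul]
      rw [smul_comm k k', mul_comm (b (pr m')) (b (pr m)), add_comm]

end LogSymbol

/-! ### Base change of an ideal -/

/-- The `A`-module `A ⊗_S J`, for a homomorphism of commutative rings `S → A` and an ideal `J`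
of `S`. -/
def IdealBaseChange {S A : Type u} [CommRing S] [CommRing A] (f : S →+* A) (J : Ideal S) : Type u :=
  letI := f.toAlgebra
  A ⊗[S] J

namespace IdealBaseChange

variable {S A : Type u} [CommRing S] [CommRing A] (f : S →+* A) (J : Ideal S)

noncomputable instance : AddCommGroup (IdealBaseChange f J) :=
  letI := f.toAlgebra
  (inferInstance : AddCommGroup (A ⊗[S] J))

noncomputable instance : Module A (IdealBaseChange f J) :=
  letI := f.toAlgebra
  (inferInstance : Module A (A ⊗[S] J))

/-- The pure tensor `a ⊗ j`. -/
noncomputable def tmul (a : A) (j : J) : IdealBaseChange f J :=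
  letI := f.toAlgebra
  a ⊗ₜ[S] j

variable {f J}

theorem induction_on {p : IdealBaseChange f J → Prop} (x : IdealBaseChange f J)
    (zero : p 0) (tmul : ∀ a j, p (tmul f J a j)) (add : ∀ x y, p x → p y → p (x + y)) : p x := by
  let := f.toAlgebra
  exact TensorProduct.induction_on x zero tmul add

theorem smul_tmul (a a' : A) (j : J) : a • tmul f J a' j = tmul f J (a * a') j := rfl

theorem tmul_add (a : A) (j j' : J) : tmul f J a (j + j') = tmul f J a j + tmul f J a j' := by
  let := f.toAlgebra
  exact TensorProduct.tmul_add a j j'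

theorem tmul_smul (a : A) (s : S) (j : J) : tmul f J a (s • j) = f s • tmul f J a j := by
  let := f.toAlgebra
  exact (TensorProduct.tmul_smul s a j).trans rfl

variable {A' D : Type u} [CommRing A'] [AddCommGroup D] [Module A' D]

/-- The `σ`-semilinear map `a ⊗ j ↦ σ a • g j`. -/
noncomputable def lift (σ : A →+* A') (g : J →ₛₗ[σ.comp f] D) : IdealBaseChange f J →ₛₗ[σ] D :=
  letI := f.toAlgebra
  letI F : A ⊗[S] J →+ D := TensorProduct.liftAddHom
    { toFun := fun a => (DistribSMul.toAddMonoidHom D (σ a)).comp g.toAddMonoidHom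
      map_zero' := by ext; simp
      map_add' := fun a a' => by ext; simp [add_smul] }
    (fun s a j => by
      change σ (f s * a) • g j = σ a • g (s • j)
      rw [g.map_smulₛₗ, smul_smul, map_mul, mul_comm]
      rfl)
  { toFun := F
    map_add' := F.map_add
    map_smul' := fun a x => by
      refine induction_on (f := f) (J := J) (p := fun x => F (a • x) = σ a • F x) x ?_ ?_ ?_
      · exact (congrArg F (smul_zero a)).trans
          (F.map_zero.trans ((smul_zero _).symm.trans (congrArg _ F.map_zero.symm)))
      · intro a' j
        change σ (a * a') • g j = σ a • σ a' • g j
        rw [map_mul, mul_smul]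
      · intro x y hx hy
        exact (congrArg F (smul_add a x y)).trans ((F.map_add _ _).trans ((congrArg₂ _ hx hy).trans
          ((smul_add _ _ _).symm.trans (congrArg _ (F.map_add x y).symm)))) }

@[simp] theorem lift_tmul (σ : A →+* A') (g : J →ₛₗ[σ.comp f] D) (a : A) (j : J) :
    lift σ g (tmul f J a j) = σ a • g j := rfl

end IdealBaseChange

/-! ### The square for one factorization `(C, Q) → (R, P) → (B, N)`

Throughout, `X = (C, Q)`, `Y = (B, N)`, and `E` is a factorization of `φ : X → Y` through the
prelog ring `E.mid = (R, P)`. -/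

noncomputable instance {C R B : Type u} [CommRing C] [CommRing R] [CommRing B]
    (f : C →+* R) (g : C →+* B) : Algebra B (RingPushout f g) :=
  (RingPushout.inr f g).toAlgebra

namespace LogSquare

variable {X Y : PrelogRing.{u}} {φ : X ⟶ Y}

section Objects

variable (E : Factorisation φ)

theorem ring_fac : E.π.ring.comp E.ι.ring = φ.ring := congrArg PrelogRing.Hom.ring E.ι_π

theorem mon_fac : E.π.mon.comp E.ι.mon = φ.mon := congrArg PrelogRing.Hom.mon E.ι_π

/-- `R ⊗_C B` -/
abbrev A : Type u := RingPushout E.ι.ring φ.ring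

/-- The augmentation `R ⊗_C B → B`. -/
noncomputable def augA : A E →+* Y.ring :=
  RingPushout.desc E.π.ring (RingHom.id _) (by rw [ring_fac, RingHom.id_comp])

@[simp] theorem augA_inr (b : Y.ring) : augA E (RingPushout.inr E.ι.ring φ.ring b) = b :=
  RingPushout.desc_inr _ _ _ b

/-- `ℤ[P] ⊗_{ℤ[Q]} ℤ[N]` -/
abbrev S : Type u :=
  RingPushout (MonoidAlgebra.mapDomainRingHom ℤ E.ι.mon) (MonoidAlgebra.mapDomainRingHom ℤ φ.mon)

/-- The augmentation `ℤ[P] ⊗_{ℤ[Q]} ℤ[N] → ℤ[N]`. -/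
noncomputable def augS : S E →+* MonoidAlgebra ℤ Y.mon :=
  RingPushout.desc (MonoidAlgebra.mapDomainRingHom ℤ E.π.mon) (RingHom.id _)
    (by rw [← MonoidAlgebra.mapDomainRingHom_comp, mon_fac, RingHom.id_comp])

/-- The canonical homomorphism `ℤ[P] ⊗_{ℤ[Q]} ℤ[N] → R ⊗_C B`. -/
noncomputable def toA : S E →+* A E :=
  RingPushout.desc
    ((RingPushout.inl E.ι.ring φ.ring).comp (monoidRingLift E.mid.α))
    ((RingPushout.inr E.ι.ring φ.ring).comp (monoidRingLift Y.α)) (by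
      refine MonoidAlgebra.ringHom_ext' (RingHom.ext_int _ _) (MonoidHom.ext fun q => ?_)
      have h := RingHom.congr_fun (RingPushout.condition E.ι.ring φ.ring) (X.α q)
      simpa [E.ι.comm, φ.comm] using h)

/-- `I = ker (R ⊗_C B → B)` -/
noncomputable abbrev I : Ideal (A E) := RingHom.ker (augA E)

/-- `J = ker (ℤ[P] ⊗_{ℤ[Q]} ℤ[N] → ℤ[N])` -/
noncomputable abbrev J : Ideal (S E) := RingHom.ker (augS E)

/-- `P ⊕_Q N` -/
abbrev Amalg : Type u := MonPushout E.ι.mon φ.mon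

/-- The canonical homomorphism `P ⊕_Q N → N`. -/
def augM : Amalg E →* Y.mon :=
  MonPushout.desc E.π.mon (MonoidHom.id _) (by rw [mon_fac, MonoidHom.id_comp])

/-- `T = ker ((P ⊕_Q N)^gp → N^gp)` -/
abbrev T : Type u := GpKer (augM E)

/-- `B ⊗_ℤ T` -/
abbrev BT : Type u := Y.ring ⊗[ℤ] Additive (T E)

/-- `U = (R ⊗_C B) ⊗_{ℤ[P] ⊗_{ℤ[Q]} ℤ[N]} J` -/
abbrev U : Type u := IdealBaseChange (toA E) (J E)

/-- `U` as a `B`-module, by means of `B → R ⊗_C B`. -/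
noncomputable instance : Module Y.ring (U E) :=
  Module.compHom (U E) (RingPushout.inr E.ι.ring φ.ring)

theorem U_smul_def (b : Y.ring) (x : U E) : b • x = RingPushout.inr E.ι.ring φ.ring b • x := rfl

theorem augA_toA (x : S E) : augA E (toA E x) = monoidRingLift Y.α (augS E x) := by
  refine RingHom.congr_fun (f := (augA E).comp (toA E))
    (g := (monoidRingLift Y.α).comp (augS E)) (RingPushout.hom_ext (fun p => ?_) (fun n => ?_)) x
  · simp only [toA, augA, augS, RingHom.comp_apply, RingPushout.desc_inl]
    refine RingHom.congr_fun (f := E.π.ring.comp (monoidRingLift E.mid.α))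
      (g := (monoidRingLift Y.α).comp (MonoidAlgebra.mapDomainRingHom ℤ E.π.mon)) ?_ p
    refine MonoidAlgebra.ringHom_ext' (RingHom.ext_int _ _) (MonoidHom.ext fun q => ?_)
    simp [E.π.comm]
  · simp [toA, augA, augS]

/-- The map `α : U → I`, `a ⊗ j ↦ a j`. -/
noncomputable def alpha : U E →ₗ[Y.ring] I E :=
  letI F : U E →ₗ[A E] I E := IdealBaseChange.lift (RingHom.id (A E))
    { toFun := fun j => ⟨toA E j, by
        rw [RingHom.mem_ker, augA_toA, (RingHom.mem_ker).1 j.2, map_zero]⟩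
      map_add' := fun j j' => Subtype.ext (map_add (toA E) _ _)
      map_smul' := fun s j => Subtype.ext (map_mul (toA E) _ _) }
  { toFun := F
    map_add' := F.map_add
    map_smul' := fun b x => F.map_smul (RingPushout.inr E.ι.ring φ.ring b) x }

@[simp] theorem alpha_tmul (a : A E) (j : J E) :
    (alpha E (IdealBaseChange.tmul (toA E) (J E) a j) : A E) = a * toA E j := rfl

/-- The canonical homomorphism `ℤ[P] ⊗_{ℤ[Q]} ℤ[N] → ℤ[P ⊕_Q N]`. -/
noncomputable def toMonoidRing : S E →+* MonoidAlgebra ℤ (Amalg E) :=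
  RingPushout.desc
    (MonoidAlgebra.mapDomainRingHom ℤ (MonPushout.inl E.ι.mon φ.mon))
    (MonoidAlgebra.mapDomainRingHom ℤ (MonPushout.inr E.ι.mon φ.mon))
    (by rw [← MonoidAlgebra.mapDomainRingHom_comp, ← MonoidAlgebra.mapDomainRingHom_comp,
      MonPushout.condition])

theorem augM_inr (n : Y.mon) : augM E (MonPushout.inr E.ι.mon φ.mon n) = n := by
  simp [augM]

theorem lift_toMonoidRing (x : S E) :
    monoidRingLift (Y.α.comp (augM E)) (toMonoidRing E x) = monoidRingLift Y.α (augS E x) := by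
  refine RingHom.congr_fun (f := (monoidRingLift (Y.α.comp (augM E))).comp (toMonoidRing E))
    (g := (monoidRingLift Y.α).comp (augS E)) (RingPushout.hom_ext (fun p => ?_) (fun n => ?_)) x
  · simp only [toMonoidRing, augS, RingHom.comp_apply, RingPushout.desc_inl]
    refine RingHom.congr_fun
      (f := (monoidRingLift (Y.α.comp (augM E))).comp
        (MonoidAlgebra.mapDomainRingHom ℤ (MonPushout.inl E.ι.mon φ.mon)))
      (g := (monoidRingLift Y.α).comp (MonoidAlgebra.mapDomainRingHom ℤ E.π.mon)) ?_ p
    refine MonoidAlgebra.ringHom_ext' (RingHom.ext_int _ _) (MonoidHom.ext fun q => ?_)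
    simp [augM]
  · simp only [toMonoidRing, augS, RingHom.comp_apply, RingPushout.desc_inr]
    refine RingHom.congr_fun
      (f := (monoidRingLift (Y.α.comp (augM E))).comp
        (MonoidAlgebra.mapDomainRingHom ℤ (MonPushout.inr E.ι.mon φ.mon)))
      (g := (monoidRingLift Y.α).comp (RingHom.id _)) ?_ n
    refine MonoidAlgebra.ringHom_ext' (RingHom.ext_int _ _) (MonoidHom.ext fun q => ?_)
    simp [augM]

/-- The map `J → B ⊗ T` that sends `p - p'`, for `p, p' ∈ P ⊕_Q N` with the same image `n` in `N`,
to `n ⊗ (p / p')`. It is linear over `ℤ[P] ⊗_{ℤ[Q]} ℤ[N] → R ⊗_C B → B`. -/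
noncomputable def symbolJ : J E →ₛₗ[(augA E).comp (toA E)] BT E where
  toFun j := logSymbol (augM E) (MonPushout.inr E.ι.mon φ.mon) (augM_inr E) Y.α (toMonoidRing E j)
  map_add' j j' := by simp
  map_smul' s j := by
    have hj : augS E j = 0 := (RingHom.mem_ker).1 j.2
    change logSymbol _ _ _ _ (toMonoidRing E (s * j)) = _
    rw [map_mul, logSymbol_mul, lift_toMonoidRing, lift_toMonoidRing, hj, map_zero, zero_smul,
      add_zero, RingHom.comp_apply, augA_toA]

/-- The map `β : U → B ⊗ T`, `a ⊗ j ↦ π(a) β(j)`, where `π : R ⊗_C B → B` is the augmentation. -/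
noncomputable def beta : U E →ₗ[Y.ring] BT E :=
  letI F : U E →ₛₗ[augA E] BT E := IdealBaseChange.lift (augA E) (symbolJ E)
  { toFun := F
    map_add' := F.map_add
    map_smul' := fun b x => by
      rw [U_smul_def, F.map_smulₛₗ, augA_inr]
      rfl }

@[simp] theorem beta_tmul (a : A E) (j : J E) :
    beta E (IdealBaseChange.tmul (toA E) (J E) a j) = augA E a • symbolJ E j := rfl

end Objects

/-! ### Functoriality in the factorization -/

section Maps

variable {E E' E'' : Factorisation φ} (f : E ⟶ E') (g : E' ⟶ E'')

theorem ι_h_ring : f.h.ring.comp E.ι.ring = E'.ι.ring := congrArg PrelogRing.Hom.ring f.ι_h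
theorem ι_h_mon : f.h.mon.comp E.ι.mon = E'.ι.mon := congrArg PrelogRing.Hom.mon f.ι_h
theorem h_π_ring : E'.π.ring.comp f.h.ring = E.π.ring := congrArg PrelogRing.Hom.ring f.h_π
theorem h_π_mon : E'.π.mon.comp f.h.mon = E.π.mon := congrArg PrelogRing.Hom.mon f.h_π

/-- The induced homomorphism `R ⊗_C B → R' ⊗_C B`. -/
noncomputable def mapA : A E →+* A E' :=
  RingPushout.desc ((RingPushout.inl _ _).comp f.h.ring) (RingPushout.inr _ _) (by
    rw [RingHom.comp_assoc, ι_h_ring, RingPushout.condition])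

/-- The induced homomorphism `ℤ[P] ⊗_{ℤ[Q]} ℤ[N] → ℤ[P'] ⊗_{ℤ[Q]} ℤ[N]`. -/
noncomputable def mapS : S E →+* S E' :=
  RingPushout.desc ((RingPushout.inl _ _).comp (MonoidAlgebra.mapDomainRingHom ℤ f.h.mon))
    (RingPushout.inr _ _) (by
    rw [RingHom.comp_assoc, ← MonoidAlgebra.mapDomainRingHom_comp, ι_h_mon, RingPushout.condition])

/-- The induced homomorphism `P ⊕_Q N → P' ⊕_Q N`. -/
def mapM : Amalg E →* Amalg E' :=
  MonPushout.desc ((MonPushout.inl _ _).comp f.h.mon) (MonPushout.inr _ _) (by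
    rw [MonoidHom.comp_assoc, ι_h_mon, MonPushout.condition])

@[simp] theorem mapA_inr (b : Y.ring) :
    mapA f (RingPushout.inr E.ι.ring φ.ring b) = RingPushout.inr E'.ι.ring φ.ring b :=
  RingPushout.desc_inr _ _ _ b

theorem mapA_id : mapA (𝟙 E) = RingHom.id (A E) :=
  RingPushout.hom_ext (fun r => by simp [mapA]) (fun b => by simp [mapA])

theorem mapA_comp : mapA (f ≫ g) = (mapA g).comp (mapA f) :=
  RingPushout.hom_ext (fun r => by simp [mapA]) (fun b => by simp [mapA])

theorem mapS_id : mapS (𝟙 E) = RingHom.id (S E) :=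
  RingPushout.hom_ext (fun r => by simp [mapS]) (fun b => by simp [mapS])

theorem mapS_comp : mapS (f ≫ g) = (mapS g).comp (mapS f) :=
  RingPushout.hom_ext (fun r => by simp [mapS]) (fun b => by simp [mapS])

theorem mapM_id : mapM (𝟙 E) = MonoidHom.id (Amalg E) :=
  MonPushout.hom_ext (fun r => by simp [mapM]) (fun b => by simp [mapM])

theorem mapM_comp : mapM (f ≫ g) = (mapM g).comp (mapM f) :=
  MonPushout.hom_ext (fun r => by simp [mapM]) (fun b => by simp [mapM])

theorem augA_mapA : (augA E').comp (mapA f) = augA E :=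
  RingPushout.hom_ext
    (fun r => by simpa [mapA, augA] using RingHom.congr_fun (h_π_ring f) r)
    (fun b => by simp [mapA, augA])

theorem augS_mapS : (augS E').comp (mapS f) = augS E :=
  RingPushout.hom_ext
    (fun r => by
      simp only [mapS, augS, RingHom.comp_apply, RingPushout.desc_inl]
      rw [← RingHom.comp_apply, ← MonoidAlgebra.mapDomainRingHom_comp, h_π_mon])
    (fun b => by simp [mapS, augS])

theorem augM_mapM : (augM E').comp (mapM f) = augM E :=
  MonPushout.hom_ext
    (fun r => by simpa [mapM, augM] using DFunLike.congr_fun (h_π_mon f) r)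
    (fun b => by simp [mapM, augM])

theorem mapA_toA : (mapA f).comp (toA E) = (toA E').comp (mapS f) :=
  RingPushout.hom_ext
    (fun r => by
      simp only [mapA, mapS, toA, RingHom.comp_apply, RingPushout.desc_inl]
      congr 1
      refine RingHom.congr_fun (f := f.h.ring.comp (monoidRingLift E.mid.α))
        (g := (monoidRingLift E'.mid.α).comp (MonoidAlgebra.mapDomainRingHom ℤ f.h.mon)) ?_ r
      refine MonoidAlgebra.ringHom_ext' (RingHom.ext_int _ _) (MonoidHom.ext fun q => ?_)
      simp [f.h.comm])
    (fun b => by simp [mapA, mapS, toA])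

theorem toMonoidRing_mapS :
    (toMonoidRing E').comp (mapS f) =
      (MonoidAlgebra.mapDomainRingHom ℤ (mapM f)).comp (toMonoidRing E) :=
  RingPushout.hom_ext
    (fun r => by
      simp only [mapS, toMonoidRing, RingHom.comp_apply, RingPushout.desc_inl]
      simp only [← RingHom.comp_apply, ← MonoidAlgebra.mapDomainRingHom_comp]
      congr 2
      ext p
      simp [mapM])
    (fun r => by
      simp only [mapS, toMonoidRing, RingHom.comp_apply, RingPushout.desc_inr]
      simp only [← RingHom.comp_apply, ← MonoidAlgebra.mapDomainRingHom_comp]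
      congr 2
      ext p
      simp [mapM])

theorem mapS_mem (j : J E) : mapS f (j : S E) ∈ J E' := by
  rw [RingHom.mem_ker, ← RingHom.comp_apply, augS_mapS]
  exact j.2

/-- The induced map `I → I'`. -/
noncomputable def mapI : I E →ₗ[Y.ring] I E' where
  toFun x := ⟨mapA f x, by
    rw [RingHom.mem_ker, ← RingHom.comp_apply, augA_mapA]
    exact x.2⟩
  map_add' x y := Subtype.ext (map_add (mapA f) _ _)
  map_smul' b x := Subtype.ext (by
    change mapA f (RingPushout.inr _ _ b * (x : A E)) = RingPushout.inr _ _ b * mapA f (x : A E)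
    rw [map_mul, mapA_inr])

/-- The induced map `U → U'`, `a ⊗ j ↦ a' ⊗ j'`, where `a'` and `j'` are the images of `a`
and `j`. -/
noncomputable def mapU : U E →ₗ[Y.ring] U E' :=
  letI F : U E →ₛₗ[mapA f] U E' := IdealBaseChange.lift (mapA f)
    { toFun := fun j => IdealBaseChange.tmul (toA E') (J E') 1 ⟨mapS f j, mapS_mem f j⟩
      map_add' := fun j j' => by
        rw [← IdealBaseChange.tmul_add]
        exact congrArg _ (Subtype.ext (map_add (mapS f) _ _))
      map_smul' := fun s j => by
        rw [mapA_toA, RingHom.comp_apply, ← IdealBaseChange.tmul_smul]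
        exact congrArg _ (Subtype.ext (map_mul (mapS f) _ _)) }
  { toFun := F
    map_add' := F.map_add
    map_smul' := fun b x => by
      rw [U_smul_def, F.map_smulₛₗ, mapA_inr]
      rfl }

theorem mapU_tmul (a : A E) (j : J E) :
    mapU f (IdealBaseChange.tmul (toA E) (J E) a j) =
      IdealBaseChange.tmul (toA E') (J E') (mapA f a) ⟨mapS f j, mapS_mem f j⟩ := by
  change mapA f a • IdealBaseChange.tmul (toA E') (J E') 1 _ = _
  rw [IdealBaseChange.smul_tmul, mul_one]

/-- The induced homomorphism `T → T'`. -/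
noncomputable def mapT : T E →* T E' :=
  ((gpMap (mapM f)).comp (gpMap (augM E)).ker.subtype).codRestrict _ (fun x => by
    rw [MonoidHom.mem_ker, MonoidHom.comp_apply, ← MonoidHom.comp_apply, ← gpMap_comp, augM_mapM]
    exact x.2)

theorem mapT_coe (x : T E) :
    (mapT f x : Algebra.GrothendieckGroup (Amalg E')) = gpMap (mapM f) x := rfl

/-- The induced map `B ⊗ T → B ⊗ T'`. -/
noncomputable def mapBT : BT E →ₗ[Y.ring] BT E' :=
  LinearMap.baseChange Y.ring (MonoidHom.toAdditive (mapT f)).toIntLinearMap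

theorem mapT_id : mapT (𝟙 E) = MonoidHom.id (T E) := by
  ext x
  simp [mapT, mapM_id, gpMap_id]

theorem mapT_comp : mapT (f ≫ g) = (mapT g).comp (mapT f) := by
  ext x
  simp [mapT, mapM_comp, gpMap_comp]

theorem alpha_mapU (x : U E) : alpha E' (mapU f x) = mapI f (alpha E x) := by
  induction x using IdealBaseChange.induction_on with
  | zero => simp only [map_zero]
  | add x y hx hy => simp only [map_add, hx, hy]
  | tmul a j =>
    rw [mapU_tmul f a j]
    refine Subtype.ext ?_
    change mapA f a * toA E' (mapS f j) = mapA f (a * toA E j)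
    rw [map_mul, ← RingHom.comp_apply, ← mapA_toA, RingHom.comp_apply]

theorem fibreRatio_mapM (m : Amalg E) :
    mapT f (fibreRatio (augM E) (MonPushout.inr E.ι.mon φ.mon) (augM_inr E) m) =
      fibreRatio (augM E') (MonPushout.inr E'.ι.mon φ.mon) (augM_inr E') (mapM f m) := by
  have h : augM E' (mapM f m) = augM E m := DFunLike.congr_fun (augM_mapM f) m
  have h' : mapM f (MonPushout.inr E.ι.mon φ.mon (augM E m)) =
      MonPushout.inr E'.ι.mon φ.mon (augM E m) := by simp [mapM]
  refine Subtype.ext ?_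
  rw [mapT_coe, fibreRatio_coe, fibreRatio_coe, map_div, gpMap_of, gpMap_of, h, h']

theorem logSymbol_mapM (x : MonoidAlgebra ℤ (Amalg E)) :
    mapBT f (logSymbol (augM E) (MonPushout.inr E.ι.mon φ.mon) (augM_inr E) Y.α x) =
      logSymbol (augM E') (MonPushout.inr E'.ι.mon φ.mon) (augM_inr E') Y.α
        (MonoidAlgebra.mapDomainRingHom ℤ (mapM f) x) := by
  induction x using MonoidAlgebra.induction_linear with
  | zero => simp only [map_zero]
  | add x y hx hy => simp only [map_add, hx, hy]
  | single m k =>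
    have h : augM E' (mapM f m) = augM E m := DFunLike.congr_fun (augM_mapM f) m
    have e : MonoidAlgebra.mapDomainRingHom ℤ (mapM f) (MonoidAlgebra.single m k) =
      MonoidAlgebra.single (mapM f m) k := by simp
    rw [e, logSymbol_single, logSymbol_single, map_zsmul, ← fibreRatio_mapM, h]
    rfl

theorem beta_mapU (x : U E) : beta E' (mapU f x) = mapBT f (beta E x) := by
  induction x using IdealBaseChange.induction_on with
  | zero => simp only [map_zero]
  | add x y hx hy => simp only [map_add, hx, hy]
  | tmul a j =>
    rw [mapU_tmul f a j, beta_tmul, beta_tmul, map_smul, ← RingHom.comp_apply, augA_mapA]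
    congr 1
    refine Eq.trans ?_ (logSymbol_mapM f _).symm
    change logSymbol _ _ _ _ (toMonoidRing E' (mapS f j)) = _
    rw [← RingHom.comp_apply, toMonoidRing_mapS, RingHom.comp_apply]

end Maps

/-- The functor `(R, P) ↦ I`, with values in `B`-modules. -/
noncomputable def functorI (φ : X ⟶ Y) : Factorisation φ ⥤ ModuleCat.{u} Y.ring where
  obj E := ModuleCat.of Y.ring (I E)
  map f := ModuleCat.ofHom (mapI f)
  map_id E := by
    ext x
    exact RingHom.congr_fun mapA_id x.1
  map_comp f g := by
    ext x
    exact RingHom.congr_fun (mapA_comp f g) x.1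

/-- The functor `(R, P) ↦ U`, with values in `B`-modules. -/
noncomputable def functorU (φ : X ⟶ Y) : Factorisation φ ⥤ ModuleCat.{u} Y.ring where
  obj E := ModuleCat.of Y.ring (U E)
  map f := ModuleCat.ofHom (mapU f)
  map_id E := by
    ext x
    change mapU (𝟙 E) x = x
    induction x using IdealBaseChange.induction_on with
    | zero => exact map_zero _
    | add x y hx hy => rw [map_add, hx, hy]
    | tmul a j =>
      have e : mapS (𝟙 E) j = j := by rw [mapS_id, RingHom.id_apply]
      rw [mapU_tmul]
      exact congrArg₂ _ (by rw [mapA_id, RingHom.id_apply]) (Subtype.ext e)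
  map_comp {E E' E''} f g := by
    ext x
    change mapU (f ≫ g) x = mapU g (mapU f x)
    induction x using IdealBaseChange.induction_on with
    | zero => simp only [map_zero]
    | add x y hx hy => simp only [map_add, hx, hy]
    | tmul a j =>
      have e : mapS (f ≫ g) j = mapS g (mapS f j) := by rw [mapS_comp, RingHom.comp_apply]
      rw [mapU_tmul, mapU_tmul, mapU_tmul]
      exact congrArg₂ _ (by rw [mapA_comp, RingHom.comp_apply]) (Subtype.ext e)

/-- The functor `(R, P) ↦ B ⊗ T`, with values in `B`-modules. -/
noncomputable def functorBT (φ : X ⟶ Y) : Factorisation φ ⥤ ModuleCat.{u} Y.ring where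
  obj E := ModuleCat.of Y.ring (BT E)
  map f := ModuleCat.ofHom (mapBT f)
  map_id E := by
    refine ModuleCat.hom_ext ?_
    change LinearMap.baseChange Y.ring (MonoidHom.toAdditive (mapT (𝟙 E))).toIntLinearMap = _
    rw [mapT_id]
    exact LinearMap.baseChange_id
  map_comp f g := by
    refine ModuleCat.hom_ext ?_
    change LinearMap.baseChange Y.ring (MonoidHom.toAdditive (mapT (f ≫ g))).toIntLinearMap = _
    rw [mapT_comp]
    change LinearMap.baseChange Y.ring ((MonoidHom.toAdditive (mapT g)).toIntLinearMap.comp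
      (MonoidHom.toAdditive (mapT f)).toIntLinearMap) = _
    exact LinearMap.baseChange_comp _ _

/-- The natural transformation `α : U → I`. -/
noncomputable def natAlpha (φ : X ⟶ Y) : functorU φ ⟶ functorI φ where
  app E := ModuleCat.ofHom (alpha E)
  naturality _ _ f := by
    ext x
    exact alpha_mapU f x

/-- The natural transformation `β : U → B ⊗ T`. -/
noncomputable def natBeta (φ : X ⟶ Y) : functorU φ ⟶ functorBT φ where
  app E := ModuleCat.ofHom (beta E)
  naturality _ _ f := by
    ext x
    exact beta_mapU f x

end LogSquare

/-! ### The simplicial modules -/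

/-- A factorization `X → Z → Y` of a homomorphism `φ : X → Y` of (constant simplicial) prelog rings
through a simplicial prelog ring `Z`, seen as a simplicial object in the category of factorizations
of `φ`. -/
def simplicialFactorisation {X Y : PrelogRing.{u}} {φ : X ⟶ Y} {Z : SimplicialObject PrelogRing.{u}}
    (i : (SimplicialObject.const PrelogRing.{u}).obj X ⟶ Z)
    (p : Z ⟶ (SimplicialObject.const PrelogRing.{u}).obj Y)
    (fac : i ≫ p = (SimplicialObject.const PrelogRing.{u}).map φ) :
    SimplicialObject (Factorisation φ) where
  obj n := ⟨Z.obj n, i.app n, p.app n, NatTrans.congr_app fac n⟩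
  map θ :=
    { h := Z.map θ
      ι_h := (i.naturality θ).symm.trans (Category.id_comp _)
      h_π := (p.naturality θ).trans (Category.comp_id _) }
  map_id n := Factorisation.Hom.ext (Z.map_id n)
  map_comp θ η := Factorisation.Hom.ext (Z.map_comp θ η)

section SimplicialModules

variable {X Y : PrelogRing.{u}} {φ : X ⟶ Y} (F : SimplicialObject (Factorisation φ))

/-- The simplicial module `I = ker (R ⊗_C B → B)`. -/
noncomputable def simplicialI : SimplicialObject (ModuleCat.{u} Y.ring) :=
  F ⋙ LogSquare.functorI φ

/-- The simplicial module `U = (R ⊗_C B) ⊗_{ℤ[P] ⊗_{ℤ[Q]} ℤ[N]} J`, where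
`J = ker (ℤ[P] ⊗_{ℤ[Q]} ℤ[N] → ℤ[N])`. -/
noncomputable def simplicialU : SimplicialObject (ModuleCat.{u} Y.ring) :=
  F ⋙ LogSquare.functorU φ

/-- The simplicial module `B ⊗_ℤ T`, where `T = ker ((P ⊕_Q N)^gp → N^gp)`. -/
noncomputable def simplicialBT : SimplicialObject (ModuleCat.{u} Y.ring) :=
  F ⋙ LogSquare.functorBT φ

/-- The map `α : U → I`. -/
noncomputable def simplicialAlpha : simplicialU F ⟶ simplicialI F :=
  Functor.whiskerLeft F (LogSquare.natAlpha φ)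

/-- The map `β : U → B ⊗_ℤ T`. -/
noncomputable def simplicialBeta : simplicialU F ⟶ simplicialBT F :=
  Functor.whiskerLeft F (LogSquare.natBeta φ)

/-- The simplicial module `D¹`, the pushout of `α : U → I` and `β : U → B ⊗_ℤ T`. -/
noncomputable def simplicialD : SimplicialObject (ModuleCat.{u} Y.ring) :=
  pushout (simplicialAlpha F) (simplicialBeta F)

/-- The canonical map `I → D¹`. -/
noncomputable def fromI : simplicialI F ⟶ simplicialD F :=
  pushout.inl (simplicialAlpha F) (simplicialBeta F)

/-- The canonical map `B ⊗_ℤ T → D¹`. -/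
noncomputable def fromBT : simplicialBT F ⟶ simplicialD F :=
  pushout.inr (simplicialAlpha F) (simplicialBeta F)

end SimplicialModules

/-- The homology `H_n` of a simplicial module: the homology of the associated chain complex, with
differential the alternating sum of the face maps. -/
noncomputable def simplicialHomology (B : Type u) [CommRing B] (n : ℕ) :
    SimplicialObject (ModuleCat.{u} B) ⥤ ModuleCat.{u} B :=
  AlgebraicTopology.alternatingFaceMapComplex (ModuleCat.{u} B) ⋙
    HomologicalComplex.homologyFunctor (ModuleCat.{u} B) (ComplexShape.down ℕ) n

/-! ### The terms `Tor_n^C(B, B)` and `W_n` -/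

/-- For a homomorphism of commutative rings `C → B`, the functor `M ↦ B ⊗_C M` from `C`-modules to
`B`-modules. -/
noncomputable def scalarExtension {C : Type w} {B : Type u} [CommRing C] [CommRing B]
    (g : C →+* B) : ModuleCat.{u} C ⥤ ModuleCat.{u} B :=
  ModuleCat.extendScalars g

instance {C : Type w} {B : Type u} [CommRing C] [CommRing B] (g : C →+* B) :
    (scalarExtension g).Additive where
  map_add {M N f f'} := by
    refine ModuleCat.ExtendScalars.hom_ext fun m => ?_
    let := g.toAlgebra
    exact TensorProduct.tmul_add (1 : B) (f m) (f' m)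

/-- The `B`-module `Tor_n^C(M, B)`, for a homomorphism of commutative rings `C → B` and a
`C`-module `M`: the value at `M` of the `n`-th left derived functor of `M ↦ B ⊗_C M`. -/
noncomputable def torModule {C : Type w} {B : Type u} [CommRing C] [Small.{u} C] [CommRing B]
    (g : C →+* B) (M : ModuleCat.{u} C) (n : ℕ) : ModuleCat.{u} B :=
  ((scalarExtension g).leftDerived n).obj M

/-- The `B`-module `Tor_n^C(B, B)`, for a homomorphism of commutative rings `C → B`. -/
noncomputable def torSelf {C B : Type u} [CommRing C] [CommRing B] (g : C →+* B) (n : ℕ) :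
    ModuleCat.{u} B :=
  torModule g ((ModuleCat.restrictScalars g).obj (ModuleCat.of B B)) n

/-- The `B`-modules `W_1 = B ⊗_ℤ ker (Q^gp → N^gp)`, `W_2 = Tor_1^ℤ(ker (Q^gp → N^gp), B)`, and
`W_n = 0` for `n ≠ 1, 2`. -/
noncomputable def termW (B : Type u) [CommRing B] {Q N : Type u} [CommMonoid Q] [CommMonoid N]
    (h : Q →* N) (n : ℕ) : ModuleCat.{u} B :=
  match n with
  | 0 => ModuleCat.of B PUnit.{u + 1}
  | 1 => ModuleCat.of B (B ⊗[ℤ] Additive (GpKer h))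
  | 2 => torModule (Int.castRingHom B) (ModuleCat.of ℤ (Additive (GpKer h))) 1
  | _ + 3 => ModuleCat.of B PUnit.{u + 1}

/-!
# The fundamental exact sequence of `D¹`

The sequence is the long exact homology sequence of `0 → U → I ⊞ B ⊗ T → D¹ → 0`, whose maps are
`(α, β)` and the difference of the maps to the pushout. It is exact as soon as `α` is injective, and
it ends with a surjection onto `H₁(D¹)` because `U₀ = 0` (`subsingleton_U`): as `P₀ = Q`, the ring
`ℤ[P₀] ⊗_{ℤ[Q]} ℤ[N]` is `ℤ[N]`, and `J₀ = 0`. Three facts remain.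

*Injectivity of `α`* (`alpha_injective`). In each degree, `R ⊗_C B = B[V ⊔ W]` is a polynomial
ring, with `V` a basis of `P` over `Q`, and sending a monomial `b v w` to `b w ⊗ (v - v')`, where
`v'` is the image of `v` in `N`, gives a left inverse of `α`.

*The homology of `I`* (`homologyIIso`). The inclusion of `I` in `R ⊗_C B` is a direct summand with
complement the constant module `B`, which has no homology in positive degrees. Since `R → B` is a
trivial fibration, `R` is a resolution of `B` by free `C`-modules (`resolutionR`), so that
`R ⊗_C B` computes `Tor^C(B, B)`.

*The homology of `B ⊗ T`* (`homologyBTIso`). Each `T_n` is free over `ℤ` (`free_T`) and is the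
quotient of `P_n^gp` by `Q^gp`. The lifting property of `P → N` carries over to the group
completions (`gp_filling_succ`): although `N` need not be cancellative, elements of `P` that become
equal in `N^gp` have equal images in `N` after multiplication by an element of `Q`, since `Q → N` is
surjective. Hence `T` is exact in degrees `≥ 2`, while `T₀ = 0` and `g ↦ δ₀(g) / δ₁(g)` identifies
`H₁(T)` with `K = ker (Q^gp → N^gp)`. So `T` shifted by one is a free resolution of `K`
(`resolutionT`), and `H_{n + 1}(B ⊗ T) = Tor_n^ℤ(K, B)`, which is zero for `n ≥ 2`.

Fillings in a trivial fibration are only needed in the form `exists_replace_face_zero`, and the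
acyclicity of a simplicial module is deduced from them by the Dold–Kan projection onto the
normalized chains (`exists_normalized_homologous`).
-/


/-! ### Filling in trivial fibrations -/

section Filling
open Opposite SSet

/-- Two `n`-simplices of a simplicial set have the same boundary if their restrictions along all
non-surjective maps to `⦋n⦌` agree. In positive dimension this is an equality of faces, see
`SameBoundary.of_δ`; in dimension `0` it is no condition. -/
def SameBoundary {K : SSet.{u}} {n : ℕ} (x x' : K _⦋n⦌) : Prop :=
  ∀ (m : SimplexCategory) (s : m ⟶ ⦋n⦌), ¬ Function.Surjective s → K.map s.op x = K.map s.op x'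

theorem SameBoundary.of_dim_zero {K : SSet.{u}} (x x' : K _⦋0⦌) : SameBoundary x x' :=
  fun _ _ hs => (hs fun _ => ⟨0, Subsingleton.elim (α := Fin 1) _ _⟩).elim

theorem SameBoundary.of_δ {K : SSet.{u}} {n : ℕ} (x x' : K _⦋n + 1⦌)
    (h : ∀ j, K.δ j x = K.δ j x') : SameBoundary x x' := fun m s hs => by
  obtain ⟨j, t, rfl⟩ := SimplexCategory.eq_comp_δ_of_not_surjective s hs
  rw [op_comp, Functor.map_comp]
  exact congrArg (K.map t.op) (h j)

theorem factor_of_zero_notMem_range {n : ℕ} {m : SimplexCategory} (f : m ⟶ ⦋n + 1⦌)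
    (h : 0 ∉ Set.range f) : (f ≫ SimplexCategory.σ 0) ≫ SimplexCategory.δ 0 = f := by
  ext k : 3
  have hk : f k ≠ 0 := fun e => h ⟨k, e⟩
  change Fin.succAbove 0 (Fin.predAbove 0 (f k)) = f k
  obtain ⟨j, hj⟩ := Fin.exists_succ_eq.2 hk
  rw [← hj]
  simp

theorem map_eq_map_δ_zero (K : SSet.{u}) {n : ℕ} (y : K _⦋n + 1⦌) {m : SimplexCategory}
    (f : m ⟶ ⦋n + 1⦌) (h : 0 ∉ Set.range f) :
    K.map f.op y = K.map (f ≫ SimplexCategory.σ 0).op (K.δ 0 y) := by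
  conv_lhs => rw [← factor_of_zero_notMem_range f h]
  rw [op_comp, Functor.map_comp]
  rfl

theorem map_σ_zero (K : SSet.{u}) {n : ℕ} (x : K _⦋n⦌) {m : SimplexCategory}
    (f : m ⟶ ⦋n + 1⦌) : K.map f.op (K.σ 0 x) = K.map (f ≫ SimplexCategory.σ 0).op x := by
  rw [op_comp, Functor.map_comp]
  rfl

open Classical in
/-- The formula that defines `replaceFaceZero` is compatible with restriction. If the vertex `0` is
avoided only after restriction, both expressions are restrictions along a non-surjective map to the
`0`-th face, where `x` and `δ₀ y` agree. -/
theorem map_replaceFaceZero {K : SSet.{u}} {n : ℕ} (y : K _⦋n + 1⦌) (x : K _⦋n⦌)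
    (h : SameBoundary x (K.δ 0 y)) {m m' : SimplexCategory} (θ : m' ⟶ m)
    (f : m ⟶ ⦋n + 1⦌) (hf : ¬ Function.Surjective f) :
    K.map (θ ≫ f).op (if 0 ∈ Set.range (θ ≫ f) then y else K.σ 0 x) =
      K.map θ.op (K.map f.op (if 0 ∈ Set.range f then y else K.σ 0 x)) := by
  rw [← ConcreteCategory.comp_apply, ← Functor.map_comp, ← op_comp]
  by_cases h₁ : 0 ∈ Set.range (θ ≫ f)
  · have h₂ : 0 ∈ Set.range f := by
      obtain ⟨k, hk⟩ := h₁
      exact ⟨θ k, by simpa using hk⟩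
    rw [if_pos h₁, if_pos h₂]
  by_cases h₂ : 0 ∈ Set.range f
  · rw [if_neg h₁, if_pos h₂]
    have e := factor_of_zero_notMem_range _ h₁
    have hs : ¬ Function.Surjective ((θ ≫ f) ≫ SimplexCategory.σ 0) := by
      intro hs
      refine hf fun j => ?_
      induction j using Fin.cases with
      | zero => exact h₂
      | succ j =>
        obtain ⟨k, hk⟩ := hs j
        refine ⟨θ k, ?_⟩
        have e' : Fin.succAbove 0 (((θ ≫ f) ≫ SimplexCategory.σ 0) k) = (θ ≫ f) k :=
          congrArg (fun g : m' ⟶ ⦋n + 1⦌ => g k) e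
        rw [hk] at e'
        exact e'.symm
    rw [map_eq_map_δ_zero K y _ h₁, map_σ_zero, h _ _ hs]
  · rw [if_neg h₁, if_neg h₂]

open Classical in
/-- The map `∂Δ[n + 1] ⟶ K` with the faces of `y`, except that the face `δ₀ y` is replaced by a
simplex `x` with the same boundary. On a simplex that avoids the vertex `0`, and so lies in the
`0`-th face, it is the restriction of `σ₀ x`, which gives a formula without choices. -/
noncomputable def replaceFaceZero {K : SSet.{u}} {n : ℕ} (y : K _⦋n + 1⦌) (x : K _⦋n⦌)
    (h : SameBoundary x (K.δ 0 y)) : (∂Δ[n + 1] : SSet.{u}) ⟶ K where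
  app m := ↾fun s => K.map (stdSimplex.objEquiv s.1).op
      (if 0 ∈ Set.range (stdSimplex.objEquiv s.1) then y else K.σ 0 x)
  naturality := by
    intro m m' θ
    ext ⟨s, hs⟩
    exact map_replaceFaceZero y x h θ.unop (stdSimplex.objEquiv s) hs

/-- Filling for a trivial fibration `f : K ⟶ L`: the face `δ₀ y` of a simplex can be replaced by
any simplex with the same boundary and the same image in `L`. -/
theorem exists_replace_face_zero {K L : SSet.{u}} (f : K ⟶ L)
    (hf : SSet.modelCategoryQuillen.I.{u}.rlp f) {n : ℕ} (y : K _⦋n + 1⦌) (x : K _⦋n⦌)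
    (h : SameBoundary x (K.δ 0 y)) (hx : f.app _ x = f.app _ (K.δ 0 y)) :
    ∃ y' : K _⦋n + 1⦌, K.δ 0 y' = x ∧ ∀ j : Fin (n + 1), K.δ j.succ y' = K.δ j.succ y := by
  have sq : CommSq (replaceFaceZero y x h) ∂Δ[n + 1].ι f (SSet.yonedaEquiv.symm (f.app _ y)) := by
    refine ⟨?_⟩
    ext m ⟨s, hs⟩
    change f.app _ (K.map (stdSimplex.objEquiv s).op
      (if 0 ∈ Set.range (stdSimplex.objEquiv s) then y else K.σ 0 x)) =
        L.map (stdSimplex.objEquiv s).op (f.app _ y)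
    refine Eq.trans ?_ (NatTrans.naturality_apply f (stdSimplex.objEquiv s).op y)
    split_ifs with h₀
    · rfl
    · rw [map_eq_map_δ_zero K y _ h₀, map_σ_zero]
      exact (NatTrans.naturality_apply f _ _).trans
        ((congrArg _ hx).trans (NatTrans.naturality_apply f _ _).symm)
  have := hf _ (modelCategoryQuillen.boundary_ι_mem_I (n + 1))
  let g : (Δ[n + 1] : SSet.{u}) ⟶ K := sq.lift
  have hg : ∀ (m : SimplexCategory) (s : m ⟶ ⦋n + 1⦌) (hs : ¬ Function.Surjective s),
      K.map s.op (SSet.yonedaEquiv g) =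
        K.map s.op (if 0 ∈ Set.range s then y else K.σ 0 x) := fun m s hs => by
    refine Eq.trans ?_ (congrArg (fun g => g.app (op m) ⟨stdSimplex.objEquiv.symm s, hs⟩)
      sq.fac_left)
    exact stdSimplex.map_objEquiv_op_apply _ _ |>.trans
      (congrArg (fun g : (Δ[n + 1] : SSet.{u}) ⟶ K => g.app (op m) (stdSimplex.objEquiv.symm s))
        (SSet.yonedaEquiv.symm_apply_apply g))
  have hδ : ∀ j : Fin (n + 2), ¬ Function.Surjective (SimplexCategory.δ j) := fun j hj => by
    obtain ⟨k, hk⟩ := hj j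
    exact Fin.succAbove_ne j k hk
  refine ⟨SSet.yonedaEquiv g, ?_, fun j => ?_⟩
  · refine (hg _ (SimplexCategory.δ 0) (hδ 0)).trans ?_
    rw [if_neg]
    · exact ConcreteCategory.congr_hom (K.δ_comp_σ_self (i := 0)) x
    · rintro ⟨k, hk⟩
      exact Fin.succAbove_ne 0 k hk
  · refine (hg _ (SimplexCategory.δ j.succ) (hδ _)).trans ?_
    rw [if_pos]
    · rfl
    · exact ⟨0, Fin.succ_succAbove_zero j⟩
end Filling

/-! ### Acyclicity of simplicial modules -/

section Acyclicity
open AlgebraicTopology AlternatingFaceMapComplex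

variable {R : Type w} [Ring R]

theorem objD_apply (M : SimplicialObject (ModuleCat.{u} R)) (n : ℕ) (x : M _⦋n + 1⦌) :
    objD M n x = ∑ i : Fin (n + 2), (-1 : ℤ) ^ (i : ℕ) • M.δ i x := by
  simp [objD]

theorem objD_apply_of_higher_faces (M : SimplicialObject (ModuleCat.{u} R)) (n : ℕ)
    (x : M _⦋n + 1⦌) (h : ∀ j : Fin (n + 1), M.δ j.succ x = 0) : objD M n x = M.δ 0 x := by
  rw [objD_apply, Fin.sum_univ_succ]
  simp [h]

/-- Every cycle of positive degree is homologous to one on which all the faces vanish. -/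
theorem exists_normalized_homologous (M : SimplicialObject (ModuleCat.{u} R)) (n : ℕ)
    (x : M _⦋n + 1⦌) (hx : objD M n x = 0) :
    ∃ (x' : M _⦋n + 1⦌) (y : M _⦋n + 2⦌), (∀ j, M.δ j x' = 0) ∧
      x = x' + objD M (n + 1) y := by
  have hd : ∀ k, (AlternatingFaceMapComplex.obj M).d (k + 1) k = objD M k :=
    alternatingFaceMapComplex_obj_d M
  have hP := (DoldKan.homotopyPInftyToId M).comm (n + 1)
  rw [dNext_eq (i := n + 1) (i' := n) _ (by simp),
    prevD_eq (j := n + 1) (j' := n + 2) _ (by simp), hd, hd] at hP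
  let P : M _⦋n + 1⦌ ⟶ M _⦋n + 1⦌ := (DoldKan.PInfty (X := M)).f (n + 1)
  let s₁ : M _⦋n⦌ ⟶ M _⦋n + 1⦌ := (DoldKan.homotopyPInftyToId M).hom n (n + 1)
  let s₂ : M _⦋n + 1⦌ ⟶ M _⦋n + 2⦌ := (DoldKan.homotopyPInftyToId M).hom (n + 1) (n + 2)
  have h₁ : ∀ j : Fin (n + 1), M.δ j.succ (P x) = 0 := fun j =>
    ConcreteCategory.congr_hom (DoldKan.HigherFacesVanish.of_P (X := M) (n + 1) n j (by omega)) x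
  have h₂ : objD M n (P x) = 0 := by
    have e := (DoldKan.PInfty (X := M)).comm (n + 1) n
    rw [hd] at e
    refine (ConcreteCategory.congr_hom e x).trans ?_
    change (DoldKan.PInfty (X := M)).f n (objD M n x) = 0
    rw [hx]
    exact map_zero _
  refine ⟨P x, -(s₂ x), ?_, ?_⟩
  · intro j
    induction j using Fin.cases with
    | zero => rw [← objD_apply_of_higher_faces M n _ h₁, h₂]
    | succ j => exact h₁ j
  · have e : P x = (s₁ (objD M n x) + objD M (n + 1) (s₂ x)) + x :=
      ConcreteCategory.congr_hom hP x
    rw [hx, map_zero] at e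
    rw [e, map_neg]
    abel

theorem exactAt_of_objD (M : SimplicialObject (ModuleCat.{u} R)) (n : ℕ)
    (h : ∀ x : M _⦋n + 1⦌, objD M n x = 0 → ∃ y, objD M (n + 1) y = x) :
    ((alternatingFaceMapComplex _).obj M).ExactAt (n + 1) := by
  rw [HomologicalComplex.exactAt_iff' _ (n + 2) (n + 1) n (by simp) (by simp),
    ShortComplex.moduleCat_exact_iff]
  intro x hx
  have hd : ∀ k, ((alternatingFaceMapComplex _).obj M).d (k + 1) k = objD M k :=
    alternatingFaceMapComplex_obj_d M
  change (((alternatingFaceMapComplex _).obj M).d (n + 1) n) x = 0 at hx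
  change ∃ y, (((alternatingFaceMapComplex _).obj M).d (n + 1 + 1) (n + 1)) y = x
  rw [hd] at hx ⊢
  exact h x hx

/-- A simplicial module has no homology in degree `n + 1` if each `(n + 1)`-simplex with zero
faces is the `0`-th face of a simplex whose other faces are zero. -/
theorem exists_objD_eq_of_normalized (M : SimplicialObject (ModuleCat.{u} R)) (n : ℕ)
    (h : ∀ x : M _⦋n + 1⦌, (∀ j, M.δ j x = 0) →
      ∃ y : M _⦋n + 2⦌, M.δ 0 y = x ∧ ∀ j : Fin (n + 2), M.δ j.succ y = 0)
    (x : M _⦋n + 1⦌) (hx : objD M n x = 0) : ∃ y, objD M (n + 1) y = x := by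
  obtain ⟨x', y, hx', e⟩ := exists_normalized_homologous M n x hx
  obtain ⟨y', h₀, h₁⟩ := h x' hx'
  refine ⟨y' + y, ?_⟩
  rw [map_add, objD_apply_of_higher_faces M _ _ h₁, h₀, e]

/-- A constant simplicial module has no homology in positive degrees. -/
theorem isZero_homology_const {B : Type u} [CommRing B] (M : ModuleCat.{u} B) (n : ℕ) :
    IsZero ((simplicialHomology B (n + 1)).obj ((SimplicialObject.const _).obj M)) := by
  refine (exactAt_of_objD _ n (exists_objD_eq_of_normalized _ n fun x hx =>
    ⟨0, ?_, fun j => map_zero _⟩)).isZero_homology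
  rw [map_zero]
  exact (hx 0).symm
end Acyclicity

/-! ### Free monoids and group completion -/

section GroupCompletion
open Algebra

theorem gp_exists_div {M : Type u} [CommMonoid M] (z : GrothendieckGroup M) :
    ∃ a b : M, z = GrothendieckGroup.of a / GrothendieckGroup.of b := by
  obtain ⟨⟨a, b⟩, h⟩ := (Localization.monoidOf (⊤ : Submonoid M)).surj z
  exact ⟨a, b, eq_div_of_mul_eq' h⟩

theorem gp_of_eq_of_iff {M : Type u} [CommMonoid M] (a b : M) :
    GrothendieckGroup.of a = GrothendieckGroup.of b ↔ ∃ c, c * a = c * b := by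
  refine ((Localization.monoidOf (⊤ : Submonoid M)).eq_iff_exists).trans ?_
  exact ⟨fun ⟨c, h⟩ => ⟨c, h⟩, fun ⟨c, h⟩ => ⟨⟨c, trivial⟩, h⟩⟩

/-- `P` is the direct sum of `Q` and of a free commutative monoid. -/
def IsFreeOver {Q P : Type u} [CommMonoid Q] [CommMonoid P] (ι : Q →* P) : Prop :=
  ∃ (V : Type u) (ψ : Q × Multiplicative (V →₀ ℕ) ≃* P), ∀ q, ψ (q, 1) = ι q

theorem IsFreeOver.of_bijective {Q P : Type u} [CommMonoid Q] [CommMonoid P] (ι : Q →* P)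
    (V : Set P) (h : Function.Bijective fun a : Q × (V →₀ ℕ) =>
      ι a.1 * a.2.prod fun v k => (v : P) ^ k) : IsFreeOver ι := by
  let f : Q × Multiplicative (V →₀ ℕ) →* P :=
    { toFun := fun a => ι a.1 * (Multiplicative.toAdd a.2).prod fun v k => (v : P) ^ k
      map_one' := by simp
      map_mul' := fun a b => by
        rw [Prod.fst_mul, Prod.snd_mul, toAdd_mul, map_mul,
          Finsupp.prod_add_index' (by simp) (by intros; exact pow_add _ _ _), mul_mul_mul_comm] }
  exact ⟨V, MulEquiv.ofBijective f h, fun q => by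
    change f (q, 1) = ι q
    simp [f]⟩

/-- `P` need not be cancellative, as `Q` need not be, but an equality that holds after multiplication
by an element of `P` holds after multiplication by its component in `Q`. -/
theorem IsFreeOver.cancel {Q P : Type u} [CommMonoid Q] [CommMonoid P] {ι : Q →* P}
    (h : IsFreeOver ι) {a x y : P} (e : a * x = a * y) : ∃ c, ι c * x = ι c * y := by
  obtain ⟨V, ψ, hψ⟩ := h
  obtain ⟨a, rfl⟩ := ψ.surjective a
  obtain ⟨x, rfl⟩ := ψ.surjective x
  obtain ⟨y, rfl⟩ := ψ.surjective y
  rw [← map_mul, ← map_mul] at e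
  have e' := ψ.injective e
  refine ⟨a.1, ?_⟩
  rw [← hψ, ← map_mul, ← map_mul]
  congr 1
  exact Prod.ext (by simpa using congrArg Prod.fst e') (by simpa using congrArg Prod.snd e')

variable {X Y : PrelogRing.{u}} {φ : X ⟶ Y} {Z : SimplicialObject PrelogRing.{u}}
    {i : (SimplicialObject.const PrelogRing.{u}).obj X ⟶ Z}
    {p : Z ⟶ (SimplicialObject.const PrelogRing.{u}).obj Y}

theorem IsFreeCofibration.isFreeOver (hi : IsFreeCofibration i) (n : ℕ) :
    IsFreeOver (i.app (Opposite.op ⦋n⦌)).mon := by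
  obtain ⟨V, -, hV, -⟩ := hi
  exact IsFreeOver.of_bijective _ (V n) (hV n)

theorem map_mon_ι (i : (SimplicialObject.const PrelogRing.{u}).obj X ⟶ Z)
    {m m' : SimplexCategoryᵒᵖ} (θ : m ⟶ m') (q : X.mon) :
    (Z.map θ).mon ((i.app m).mon q) = (i.app m').mon q :=
  (DFunLike.congr_fun (congrArg PrelogRing.Hom.mon (i.naturality θ)) q).symm

theorem π_map_mon (p : Z ⟶ (SimplicialObject.const PrelogRing.{u}).obj Y)
    {m m' : SimplexCategoryᵒᵖ} (θ : m ⟶ m') (a : (Z.obj m).mon) :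
    (p.app m').mon ((Z.map θ).mon a) = (p.app m).mon a :=
  DFunLike.congr_fun (congrArg PrelogRing.Hom.mon (p.naturality θ)) a

theorem π_ι_mon (fac : i ≫ p = (SimplicialObject.const PrelogRing.{u}).map φ)
    (m : SimplexCategoryᵒᵖ) (q : X.mon) : (p.app m).mon ((i.app m).mon q) = φ.mon q :=
  DFunLike.congr_fun (congrArg PrelogRing.Hom.mon (NatTrans.congr_app fac m)) q

/-- If `a, b ∈ P_n` have the same boundary and the same image in `N`, then `a / b ∈ P_n^gp` is the
`0`-th face of an element of which the other faces are trivial. -/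
theorem gp_filling_of_sameBoundary (hp : IsTrivialFibration p) {n : ℕ} (a b : (Z _⦋n⦌).mon)
    (h : SameBoundary (K := Z ⋙ PrelogRing.forgetMon) a b)
    (hab : (p.app _).mon a = (p.app _).mon b) :
    ∃ w : GrothendieckGroup (Z _⦋n + 1⦌).mon,
      gpMap (Z.δ 0).mon w = GrothendieckGroup.of a / GrothendieckGroup.of b ∧
      ∀ j : Fin (n + 1), gpMap (Z.δ j.succ).mon w = 1 := by
  let s : (Z _⦋n + 1⦌).mon := (Z.σ 0).mon b
  have e : (Z.δ 0).mon s = b :=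
    DFunLike.congr_fun (congrArg PrelogRing.Hom.mon (Z.δ_comp_σ_self (i := (0 : Fin (n + 1))))) b
  obtain ⟨y, h₀, h₁⟩ : ∃ y : (Z _⦋n + 1⦌).mon, (Z.δ 0).mon y = a ∧
      ∀ j : Fin (n + 1), (Z.δ j.succ).mon y = (Z.δ j.succ).mon s :=
    exists_replace_face_zero _ hp.2 (n := n) s a
    (by
      change SameBoundary (K := Z ⋙ PrelogRing.forgetMon) a ((Z.δ 0).mon s)
      rwa [e])
    (by
      change (p.app _).mon a = (p.app _).mon ((Z.δ 0).mon s)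
      rwa [e])
  refine ⟨GrothendieckGroup.of y / GrothendieckGroup.of s, ?_, fun j => ?_⟩
  · rw [map_div, gpMap_of, gpMap_of, h₀, e]
  · rw [map_div, gpMap_of, gpMap_of, h₁, div_self']

/-- If `a, b ∈ P` have the same image in `N^gp`, then they have the same image in `N` after
multiplication by an element of `Q`, because `Q → N` is surjective. -/
theorem exists_multiplier (fac : i ≫ p = (SimplicialObject.const PrelogRing.{u}).map φ)
    (hmon : Function.Surjective φ.mon) {n : ℕ} (a b : (Z _⦋n⦌).mon)
    (h : gpMap (p.app _).mon (GrothendieckGroup.of a / GrothendieckGroup.of b) = 1) :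
    ∃ c : X.mon, (p.app _).mon ((i.app _).mon c * a) = (p.app _).mon ((i.app _).mon c * b) := by
  rw [map_div, gpMap_of, gpMap_of, div_eq_one, gp_of_eq_of_iff] at h
  obtain ⟨c, hc⟩ := h
  obtain ⟨c, rfl⟩ := hmon c
  exact ⟨c, by rw [map_mul, map_mul, π_ι_mon fac]; exact hc⟩

theorem gp_div_mul_left {M : Type u} [CommMonoid M] (c a b : M) :
    (GrothendieckGroup.of (c * a) / GrothendieckGroup.of (c * b) : GrothendieckGroup M) =
      GrothendieckGroup.of a / GrothendieckGroup.of b := by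
  rw [map_mul, map_mul, mul_div_mul_left_eq_div]

/-- The kernel of `P₀^gp → N^gp` consists of `0`-th faces of elements with trivial other face. -/
theorem gp_filling_zero (fac : i ≫ p = (SimplicialObject.const PrelogRing.{u}).map φ)
    (hmon : Function.Surjective φ.mon) (hp : IsTrivialFibration p)
    (z : GrothendieckGroup (Z _⦋0⦌).mon) (hz : gpMap (p.app _).mon z = 1) :
    ∃ w : GrothendieckGroup (Z _⦋1⦌).mon,
      gpMap (Z.δ 0).mon w = z ∧ gpMap (Z.δ 1).mon w = 1 := by
  obtain ⟨a, b, rfl⟩ := gp_exists_div z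
  obtain ⟨c, hc⟩ := exists_multiplier fac hmon a b hz
  obtain ⟨w, h₀, h₁⟩ := gp_filling_of_sameBoundary hp _ _ (SameBoundary.of_dim_zero _ _) hc
  exact ⟨w, h₀.trans (gp_div_mul_left _ _ _), h₁ 0⟩

/-- An element `a / b` of `P_{n + 1}^gp` with trivial faces is the `0`-th face of an element of which
the other faces are trivial: multiplying `a` and `b` by a suitable element of `Q` makes their faces
and their images in `N` equal. -/
theorem gp_filling_succ (fac : i ≫ p = (SimplicialObject.const PrelogRing.{u}).map φ)
    (hmon : Function.Surjective φ.mon) (hi : IsFreeCofibration i) (hp : IsTrivialFibration p)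
    {n : ℕ} (z : GrothendieckGroup (Z _⦋n + 1⦌).mon) (hz : ∀ j, gpMap (Z.δ j).mon z = 1) :
    ∃ w : GrothendieckGroup (Z _⦋n + 2⦌).mon,
      gpMap (Z.δ 0).mon w = z ∧ ∀ j : Fin (n + 2), gpMap (Z.δ j.succ).mon w = 1 := by
  have hπ : gpMap (p.app _).mon z = 1 := by
    have e : (p.app _).mon.comp (Z.δ 0).mon = (p.app _).mon :=
      MonoidHom.ext fun a => π_map_mon p (SimplexCategory.δ (n := n) 0).op a
    rw [← e, gpMap_comp, MonoidHom.comp_apply, hz, map_one]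
  obtain ⟨a, b, rfl⟩ := gp_exists_div z
  obtain ⟨c, hc⟩ := exists_multiplier fac hmon a b hπ
  have hj : ∀ j, ∃ d : X.mon, (i.app _).mon d * (Z.δ j).mon a = (i.app _).mon d * (Z.δ j).mon b := by
    intro j
    have := hz j
    rw [map_div, gpMap_of, gpMap_of, div_eq_one, gp_of_eq_of_iff] at this
    obtain ⟨r, hr⟩ := this
    exact (hi.isFreeOver n).cancel hr
  choose d hd using hj
  -- `c` makes the images in `N` equal, and `d j` the `j`-th faces; the product does both.
  let c' := c * ∏ j, d j
  have hc' : (p.app _).mon ((i.app _).mon c' * a) = (p.app _).mon ((i.app _).mon c' * b) := by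
    have e : ∀ x, (i.app (Opposite.op ⦋n + 1⦌)).mon c' * x =
        (i.app _).mon (∏ j, d j) * ((i.app _).mon c * x) := fun x => by
      rw [map_mul, mul_comm ((i.app _).mon c), mul_assoc]
    rw [e, e, map_mul, hc, ← map_mul]
  have hd' : ∀ j, (Z.δ j).mon ((i.app _).mon c' * a) = (Z.δ j).mon ((i.app _).mon c' * b) := by
    intro j
    obtain ⟨e, he⟩ : d j ∣ c' := Dvd.dvd.mul_left (Finset.dvd_prod_of_mem d (Finset.mem_univ j)) c
    have hδ : ∀ x, (Z.δ j).mon ((i.app (Opposite.op ⦋n + 1⦌)).mon c' * x) =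
        (i.app _).mon e * ((i.app _).mon (d j) * (Z.δ j).mon x) := fun x => by
      have e' : (Z.δ j).mon ((i.app (Opposite.op ⦋n + 1⦌)).mon c') = (i.app _).mon c' :=
        map_mon_ι i _ _
      rw [map_mul, e', he, map_mul, mul_comm ((i.app _).mon (d j)), mul_assoc]
    rw [hδ, hδ, hd]
  obtain ⟨w, h₀, h₁⟩ := gp_filling_of_sameBoundary hp _ _ (SameBoundary.of_δ _ _ hd') hc'
  exact ⟨w, h₀.trans (gp_div_mul_left _ _ _), h₁⟩
end GroupCompletion

/-! ### The kernel `T` for one factorization -/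

namespace LogSquare
open Algebra

variable {X Y : PrelogRing.{u}} {φ : X ⟶ Y}

section
variable (E : Factorisation φ)

theorem augM_comp_inl : (augM E).comp (MonPushout.inl E.ι.mon φ.mon) = E.π.mon :=
  MonoidHom.ext fun a => by simp [augM]

theorem augM_comp_inr : (augM E).comp (MonPushout.inr E.ι.mon φ.mon) = MonoidHom.id _ :=
  MonoidHom.ext fun a => by simp [augM]

theorem gpMap_augM_inl (g) : gpMap (augM E) (gpMap (MonPushout.inl E.ι.mon φ.mon) g) =
    gpMap E.π.mon g := by
  rw [← MonoidHom.comp_apply, ← gpMap_comp, augM_comp_inl]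

theorem gpMap_augM_inr (m) : gpMap (augM E) (gpMap (MonPushout.inr E.ι.mon φ.mon) m) = m := by
  rw [← MonoidHom.comp_apply, ← gpMap_comp, augM_comp_inr, gpMap_id, MonoidHom.id_apply]

/-- The homomorphism `P^gp → T`, `g ↦ g / π(g)`, where `π(g)` is seen in `(P ⊕_Q N)^gp` by means
of `N`. -/
noncomputable def toT : GrothendieckGroup E.mid.mon →* T E :=
  (gpMap (MonPushout.inl E.ι.mon φ.mon) /
    (gpMap (MonPushout.inr E.ι.mon φ.mon)).comp (gpMap E.π.mon)).codRestrict _ (fun g => by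
      rw [MonoidHom.mem_ker, MonoidHom.div_apply, map_div, MonoidHom.comp_apply, gpMap_augM_inl,
        gpMap_augM_inr, div_self'])

theorem toT_coe (g : GrothendieckGroup E.mid.mon) :
    (toT E g : GrothendieckGroup (Amalg E)) = gpMap (MonPushout.inl E.ι.mon φ.mon) g /
      gpMap (MonPushout.inr E.ι.mon φ.mon) (gpMap E.π.mon g) := rfl

/-- `(P ⊕_Q N)^gp` is generated by the images of `P^gp` and `N^gp`. -/
theorem gp_amalg_exists (x : GrothendieckGroup (Amalg E)) :
    ∃ g m, x = gpMap (MonPushout.inl E.ι.mon φ.mon) g * gpMap (MonPushout.inr E.ι.mon φ.mon) m := by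
  have key : ∀ a : Amalg E, ∃ g m, GrothendieckGroup.of a =
      gpMap (MonPushout.inl E.ι.mon φ.mon) g * gpMap (MonPushout.inr E.ι.mon φ.mon) m := by
    intro a
    obtain ⟨⟨b, n⟩, rfl⟩ := Con.mk'_surjective a
    refine ⟨GrothendieckGroup.of b, GrothendieckGroup.of n, ?_⟩
    rw [gpMap_of, gpMap_of, ← map_mul]
    congr 1
    change MonPushout.mk _ _ (b, n) = MonPushout.mk _ _ (b, 1) * MonPushout.mk _ _ (1, n)
    rw [← map_mul]
    simp
  obtain ⟨a, b, rfl⟩ := gp_exists_div x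
  obtain ⟨g, m, h⟩ := key a
  obtain ⟨g', m', h'⟩ := key b
  exact ⟨g / g', m / m', by rw [h, h', map_div, map_div, mul_div_mul_comm]⟩

theorem toT_surjective : Function.Surjective (toT E) := by
  rintro ⟨x, hx⟩
  obtain ⟨g, m, rfl⟩ := gp_amalg_exists E x
  rw [MonoidHom.mem_ker, map_mul, gpMap_augM_inl, gpMap_augM_inr] at hx
  refine ⟨g, Subtype.ext ?_⟩
  rw [toT_coe, eq_inv_of_mul_eq_one_left hx, map_inv, div_inv_eq_mul]

theorem gpMap_ι_π (q) : gpMap E.π.mon (gpMap E.ι.mon q) = gpMap φ.mon q := by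
  rw [← MonoidHom.comp_apply, ← gpMap_comp, mon_fac]

theorem gpMap_inl_ι (q) : gpMap (MonPushout.inl E.ι.mon φ.mon) (gpMap E.ι.mon q) =
    gpMap (MonPushout.inr E.ι.mon φ.mon) (gpMap φ.mon q) := by
  rw [← MonoidHom.comp_apply, ← MonoidHom.comp_apply, ← gpMap_comp, ← gpMap_comp,
    MonPushout.condition]

theorem toT_ι (q) : toT E (gpMap E.ι.mon q) = 1 := by
  refine Subtype.ext ?_
  rw [toT_coe, gpMap_ι_π, gpMap_inl_ι, div_self']
  rfl

/-- The kernel of `P^gp → T` is contained in the image of `Q^gp`, as `(P ⊕_Q N)^gp` maps to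
`P^gp / Q^gp`. -/
theorem exists_of_toT_eq_one {g} (h : toT E g = 1) : ∃ q, gpMap E.ι.mon q = g := by
  let H := (gpMap E.ι.mon).range
  let f : GrothendieckGroup (Amalg E) →* GrothendieckGroup E.mid.mon ⧸ H :=
    GrothendieckGroup.lift (MonPushout.desc ((QuotientGroup.mk' H).comp GrothendieckGroup.of) 1 (by
      ext q
      simp only [MonoidHom.comp_apply, MonoidHom.one_apply]
      exact (QuotientGroup.eq_one_iff _).2 ⟨GrothendieckGroup.of q, gpMap_of _ _⟩))
  have hof : ∀ a, f (GrothendieckGroup.of a) = _ := fun a => DFunLike.congr_fun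
    (GrothendieckGroup.lift.symm_apply_apply _) a
  have h₁ : ∀ g, f (gpMap (MonPushout.inl E.ι.mon φ.mon) g) = QuotientGroup.mk' H g :=
    DFunLike.congr_fun (f := f.comp (gpMap _)) (gp_hom_ext fun a => by
      rw [MonoidHom.comp_apply, gpMap_of, hof, MonPushout.desc_inl]
      rfl)
  have h₂ : ∀ g, f (gpMap (MonPushout.inr E.ι.mon φ.mon) g) = 1 :=
    DFunLike.congr_fun (f := f.comp (gpMap _)) (g := 1) (gp_hom_ext fun a => by
      rw [MonoidHom.comp_apply, gpMap_of, hof, MonPushout.desc_inr]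
      rfl)
  have e : f (toT E g : GrothendieckGroup (Amalg E)) = 1 := by
    rw [h]
    exact map_one f
  rw [toT_coe, map_div, h₁, h₂, div_one] at e
  exact (QuotientGroup.eq_one_iff _).1 e

variable {E}

theorem mapT_toT {E' : Factorisation φ} (f : E ⟶ E') (g) :
    mapT f (toT E g) = toT E' (gpMap f.h.mon g) := by
  have h₁ : (mapM f).comp (MonPushout.inl _ _) = (MonPushout.inl _ _).comp f.h.mon :=
    MonoidHom.ext fun a => by simp [mapM]
  have h₂ : (mapM f).comp (MonPushout.inr _ _) = MonPushout.inr _ _ :=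
    MonoidHom.ext fun a => by simp [mapM]
  refine Subtype.ext ?_
  rw [mapT_coe, toT_coe, toT_coe, map_div]
  simp only [← MonoidHom.comp_apply, ← gpMap_comp]
  rw [h₁, h_π_mon, ← MonoidHom.comp_assoc, h₂]

theorem _root_.IsFreeOver.gpMap_injective {Q P : Type u} [CommMonoid Q] [CommMonoid P]
    {ι : Q →* P} (h : IsFreeOver ι) : Function.Injective (gpMap ι) := by
  obtain ⟨V, ψ, hψ⟩ := h
  let r : P →* Q := (MonoidHom.fst _ _).comp ψ.symm.toMonoidHom
  have hr : r.comp ι = MonoidHom.id Q := MonoidHom.ext fun q => by simp [r, ← hψ]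
  refine Function.LeftInverse.injective (g := gpMap r) fun x => ?_
  rw [← MonoidHom.comp_apply, ← gpMap_comp, hr, gpMap_id, MonoidHom.id_apply]

/-- If `P` is the direct sum of `Q` and of a free commutative monoid on `V`, then `T` is free on
`V`. -/
theorem free_T (h : IsFreeOver E.ι.mon) : Module.Free ℤ (Additive (T E)) := by
  obtain ⟨V, ψ, hψ⟩ := h
  let c : E.mid.mon →* Multiplicative (V →₀ ℤ) :=
    (AddMonoidHom.toMultiplicative (Finsupp.mapRange.addMonoidHom (Nat.castAddMonoidHom ℤ))).comp
      ((MonoidHom.snd _ _).comp ψ.symm.toMonoidHom)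
  have hc : ∀ a b, c a = c b → (ψ.symm a).2 = (ψ.symm b).2 := fun a b e =>
    Finsupp.mapRange_injective _ (by simp) Nat.cast_injective e
  let f : GrothendieckGroup (Amalg E) →* Multiplicative (V →₀ ℤ) :=
    GrothendieckGroup.lift (MonPushout.desc c 1 (by
      ext q : 1
      simp [c, ← hψ]))
  have hof : ∀ a, f (GrothendieckGroup.of a) = _ := fun a => DFunLike.congr_fun
    (GrothendieckGroup.lift.symm_apply_apply _) a
  have h₁ : ∀ a, f (gpMap (MonPushout.inl E.ι.mon φ.mon) (GrothendieckGroup.of a)) = c a :=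
    fun a => by rw [gpMap_of, hof, MonPushout.desc_inl]
  have h₂ : ∀ g, f (gpMap (MonPushout.inr E.ι.mon φ.mon) g) = 1 :=
    DFunLike.congr_fun (f := f.comp (gpMap _)) (g := 1) (gp_hom_ext fun a => by
      rw [MonoidHom.comp_apply, gpMap_of, hof, MonPushout.desc_inr]
      rfl)
  let F : T E →* Multiplicative (V →₀ ℤ) := f.comp (Subgroup.subtype _)
  have hF₀ : ∀ a, F (toT E (GrothendieckGroup.of a)) = c a := fun a => by
    change f (toT E (GrothendieckGroup.of a) : GrothendieckGroup (Amalg E)) = c a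
    rw [toT_coe, map_div, h₂, div_one, h₁]
  have hinj : Function.Injective F := by
    refine (injective_iff_map_eq_one F).2 fun t ht => ?_
    obtain ⟨g, rfl⟩ := toT_surjective E t
    obtain ⟨a, b, rfl⟩ := gp_exists_div g
    rw [map_div, map_div, hF₀, hF₀, div_eq_one] at ht
    have e' := hc a b ht
    have hdec : ∀ a, GrothendieckGroup.of a =
        gpMap E.ι.mon (GrothendieckGroup.of (ψ.symm a).1) *
          GrothendieckGroup.of (ψ (1, (ψ.symm a).2)) := fun a => by
      rw [gpMap_of, ← hψ, ← map_mul, ← map_mul, Prod.mk_mul_mk, mul_one, one_mul, Prod.mk.eta,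
        MulEquiv.apply_symm_apply]
    rw [hdec a, hdec b, e', mul_div_mul_right_eq_div, ← map_div, toT_ι]
  have hsurj : Function.Surjective F := by
    intro x
    change ∃ t, Multiplicative.toAdd (F t) = Multiplicative.toAdd x
    induction Multiplicative.toAdd x using Finsupp.induction_linear with
    | zero => exact ⟨1, by simp⟩
    | add y z hy hz =>
      obtain ⟨t, ht⟩ := hy
      obtain ⟨t', ht'⟩ := hz
      exact ⟨t * t', by rw [map_mul, toAdd_mul, ht, ht']⟩
    | single v k =>
      let t : T E := toT E (GrothendieckGroup.of (ψ (1, Multiplicative.ofAdd (Finsupp.single v 1))))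
      have ht : Multiplicative.toAdd (F t) = Finsupp.single v 1 := by
        rw [hF₀]
        change Finsupp.mapRange (Nat.castAddMonoidHom ℤ) (map_zero _)
          (ψ.symm (ψ (1, Multiplicative.ofAdd (Finsupp.single v 1)))).2 = _
        rw [MulEquiv.symm_apply_apply]
        change Finsupp.mapRange (Nat.castAddMonoidHom ℤ) (map_zero _) (Finsupp.single v 1) = _
        simp [Finsupp.mapRange_single]
      exact ⟨t ^ k, by rw [map_zpow, toAdd_zpow, ht]; simp⟩
  let L : Additive (T E) →ₗ[ℤ] (V →₀ ℤ) := (MonoidHom.toAdditive F).toIntLinearMap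
  exact Module.Free.of_equiv (LinearEquiv.ofBijective L ⟨hinj, hsurj⟩).symm
end

/-- The functor `(R, P) ↦ T`, with values in abelian groups. -/
noncomputable def functorT (φ : X ⟶ Y) : Factorisation φ ⥤ ModuleCat.{u} ℤ where
  obj E := ModuleCat.of ℤ (Additive (T E))
  map f := ModuleCat.ofHom (MonoidHom.toAdditive (mapT f)).toIntLinearMap
  map_id E := by
    rw [mapT_id]
    rfl
  map_comp f g := by
    rw [mapT_comp]
    rfl

end LogSquare

/-! ### The simplicial abelian group `T` -/

section SimplicialT
open Algebra LogSquare AlgebraicTopology AlternatingFaceMapComplex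

variable {X Y : PrelogRing.{u}} {φ : X ⟶ Y} {Z : SimplicialObject PrelogRing.{u}}
    {i : (SimplicialObject.const PrelogRing.{u}).obj X ⟶ Z}
    {p : Z ⟶ (SimplicialObject.const PrelogRing.{u}).obj Y}
    (fac : i ≫ p = (SimplicialObject.const PrelogRing.{u}).map φ)

theorem objD_one_apply {R : Type w} [Ring R] (M : SimplicialObject (ModuleCat.{u} R))
    (x : M _⦋2⦌) : objD M 1 x = M.δ 0 x - M.δ 1 x + M.δ 2 x := by
  rw [objD_apply, Fin.sum_univ_three]
  simp [sub_eq_add_neg]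

/-- The simplicial abelian group `T = ker ((P ⊕_Q N)^gp → N^gp)`. -/
noncomputable def simplicialT (F : SimplicialObject (Factorisation φ)) :
    SimplicialObject (ModuleCat.{u} ℤ) :=
  F ⋙ functorT φ

/-- The map `P^gp → T` in simplicial degree `n`, with values in the additive notation. -/
noncomputable def symT (n : ℕ) (g : GrothendieckGroup (Z _⦋n⦌).mon) :
    (simplicialT (simplicialFactorisation i p fac)) _⦋n⦌ :=
  Additive.ofMul (toT ((simplicialFactorisation i p fac).obj (Opposite.op ⦋n⦌)) g)

theorem symT_surjective (n : ℕ) : Function.Surjective (symT fac n) :=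
  toT_surjective ((simplicialFactorisation i p fac).obj (Opposite.op ⦋n⦌))

theorem symT_div (n : ℕ) (g h) : symT fac n (g / h) = symT fac n g - symT fac n h :=
  (congrArg Additive.ofMul
    (map_div (toT ((simplicialFactorisation i p fac).obj (Opposite.op ⦋n⦌))) g h)).trans
    (ofMul_div _ _)

theorem symT_one (n : ℕ) : symT fac n 1 = 0 :=
  congrArg Additive.ofMul
    (map_one (toT ((simplicialFactorisation i p fac).obj (Opposite.op ⦋n⦌))))

theorem symT_ι (n : ℕ) (q) : symT fac n (gpMap (i.app (Opposite.op ⦋n⦌)).mon q) = 0 :=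
  congrArg Additive.ofMul
    (toT_ι ((simplicialFactorisation i p fac).obj (Opposite.op ⦋n⦌)) q)

theorem exists_of_symT_eq_zero {n : ℕ} {g} (h : symT fac n g = 0) :
    ∃ q, gpMap (i.app (Opposite.op ⦋n⦌)).mon q = g :=
  exists_of_toT_eq_one ((simplicialFactorisation i p fac).obj (Opposite.op ⦋n⦌)) h

theorem δ_symT (n : ℕ) (j : Fin (n + 2)) (g) :
    (simplicialT (simplicialFactorisation i p fac)).δ j (symT fac (n + 1) g) =
      symT fac n (gpMap (Z.δ j).mon g) :=
  congrArg Additive.ofMul (mapT_toT ((simplicialFactorisation i p fac).δ j) g)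

theorem gpMap_δ_ι (i : (SimplicialObject.const PrelogRing.{u}).obj X ⟶ Z) (n : ℕ)
    (j : Fin (n + 2)) (q) :
    gpMap (Z.δ j).mon (gpMap (i.app (Opposite.op ⦋n + 1⦌)).mon q) =
      gpMap (i.app (Opposite.op ⦋n⦌)).mon q := by
  rw [← MonoidHom.comp_apply, ← gpMap_comp]
  congr 2
  exact MonoidHom.ext fun q => map_mon_ι i _ q

theorem gpMap_δ_δ (Z : SimplicialObject PrelogRing.{u}) {n : ℕ} {j k : Fin (n + 2)} (h : j ≤ k)
    (g) : gpMap (Z.δ j).mon (gpMap (Z.δ k.succ).mon g) =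
      gpMap (Z.δ k).mon (gpMap (Z.δ j.castSucc).mon g) := by
  have e := congrArg PrelogRing.Hom.mon (Z.δ_comp_δ h)
  rw [PrelogRing.comp_mon, PrelogRing.comp_mon] at e
  rw [← MonoidHom.comp_apply, ← MonoidHom.comp_apply, ← gpMap_comp, ← gpMap_comp, e]

variable (hmon : Function.Surjective φ.mon) (hi : IsFreeCofibration i) (hp : IsTrivialFibration p)

include hmon hi hp in
/-- If all the faces of `g ∈ P^gp` agree with the same element of `Q^gp`, the class of `g` in `T`
is the `0`-th face of an element whose other faces vanish. -/
theorem symT_filling {n : ℕ} (g : GrothendieckGroup (Z _⦋n + 1⦌).mon) (q)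
    (h : ∀ j, gpMap (Z.δ j).mon g = gpMap (i.app (Opposite.op ⦋n⦌)).mon q) :
    ∃ w, (simplicialT (simplicialFactorisation i p fac)).δ 0 w = symT fac (n + 1) g ∧
      ∀ j : Fin (n + 2), (simplicialT (simplicialFactorisation i p fac)).δ j.succ w = 0 := by
  obtain ⟨w, h₀, h₁⟩ := gp_filling_succ fac hmon hi hp
    (g / gpMap (i.app (Opposite.op ⦋n + 1⦌)).mon q)
    (fun j => by rw [map_div, gpMap_δ_ι, h, div_self'])
  refine ⟨symT fac _ w, ?_, fun j => ?_⟩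
  · rw [δ_symT, h₀, symT_div, symT_ι, sub_zero]
  · rw [δ_symT, h₁, symT_one]

include hmon hi hp in
/-- Lifting an element of `T_{n + 2}` with zero faces to `P^gp`, its faces come from elements of `Q^gp`,
which all coincide by the simplicial identities. This takes two faces of faces to compare, so that
the argument fails in degree `1`, where `T` has homology. -/
theorem simplicialT_normalized_filling (n : ℕ)
    (x : (simplicialT (simplicialFactorisation i p fac)) _⦋n + 2⦌)
    (hx : ∀ j, (simplicialT (simplicialFactorisation i p fac)).δ j x = 0) :
    ∃ y, (simplicialT (simplicialFactorisation i p fac)).δ 0 y = x ∧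
      ∀ j : Fin (n + 3), (simplicialT (simplicialFactorisation i p fac)).δ j.succ y = 0 := by
  obtain ⟨g, rfl⟩ := symT_surjective fac _ x
  have h : ∀ j, ∃ q, gpMap (i.app (Opposite.op ⦋n + 1⦌)).mon q = gpMap (Z.δ j).mon g := fun j =>
    exists_of_symT_eq_zero fac ((δ_symT fac (n + 1) j g).symm.trans (hx j))
  choose q hq using h
  have hq' : ∀ j : Fin (n + 2), q j.succ = q 0 := fun j => by
    apply (hi.isFreeOver n).gpMap_injective
    rw [← gpMap_δ_ι i n 0, ← gpMap_δ_ι i n j, hq, hq, gpMap_δ_δ Z (Fin.zero_le j)]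
    rfl
  refine symT_filling fac hmon hi hp g (q 0) fun j => ?_
  induction j using Fin.cases with
  | zero => rw [hq]
  | succ j => rw [← hq', hq]

variable (hi₀ : IsIso (i.app (Opposite.op ⦋0⦌)))

/-- The isomorphism `P₀ → Q`, inverse to `Q → P₀`. -/
noncomputable def degZeroInv (hi₀ : IsIso (i.app (Opposite.op ⦋0⦌))) : (Z _⦋0⦌).mon →* X.mon :=
  (inv (i.app (Opposite.op ⦋0⦌))).mon

theorem ι_degZeroInv (a) : (i.app (Opposite.op ⦋0⦌)).mon (degZeroInv hi₀ a) = a :=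
  DFunLike.congr_fun (congrArg PrelogRing.Hom.mon (IsIso.inv_hom_id (i.app (Opposite.op ⦋0⦌)))) a

theorem degZeroInv_ι (q) : degZeroInv hi₀ ((i.app (Opposite.op ⦋0⦌)).mon q) = q :=
  DFunLike.congr_fun (congrArg PrelogRing.Hom.mon (IsIso.hom_inv_id (i.app (Opposite.op ⦋0⦌)))) q

theorem gpMap_ι_degZeroInv (a) :
    gpMap (i.app (Opposite.op ⦋0⦌)).mon (gpMap (degZeroInv hi₀) a) = a := by
  have e : (i.app (Opposite.op ⦋0⦌)).mon.comp (degZeroInv hi₀) = MonoidHom.id _ :=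
    MonoidHom.ext (ι_degZeroInv hi₀)
  rw [← MonoidHom.comp_apply, ← gpMap_comp, e, gpMap_id, MonoidHom.id_apply]

theorem gpMap_degZeroInv_ι (q) :
    gpMap (degZeroInv hi₀) (gpMap (i.app (Opposite.op ⦋0⦌)).mon q) = q := by
  have e : (degZeroInv hi₀).comp (i.app (Opposite.op ⦋0⦌)).mon = MonoidHom.id _ :=
    MonoidHom.ext (degZeroInv_ι hi₀)
  rw [← MonoidHom.comp_apply, ← gpMap_comp, e, gpMap_id, MonoidHom.id_apply]

include hi₀ in
theorem simplicialT_zero (x : (simplicialT (simplicialFactorisation i p fac)) _⦋0⦌) : x = 0 := by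
  obtain ⟨g, rfl⟩ := symT_surjective fac _ x
  rw [← gpMap_ι_degZeroInv hi₀ g, symT_ι]

/-- The map `P₁^gp → Q^gp`, `g ↦ δ₀(g) / δ₁(g)`. -/
noncomputable def faceQuotient (hi₀ : IsIso (i.app (Opposite.op ⦋0⦌))) :
    GrothendieckGroup (Z _⦋1⦌).mon →* GrothendieckGroup X.mon :=
  (gpMap (degZeroInv hi₀)).comp (gpMap (Z.δ 0).mon / gpMap (Z.δ 1).mon)

include fac in
theorem gpMap_φ_degZeroInv (a) : gpMap φ.mon (gpMap (degZeroInv hi₀) a) =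
    gpMap (p.app (Opposite.op ⦋0⦌)).mon a := by
  rw [← MonoidHom.comp_apply, ← gpMap_comp]
  congr 2
  refine MonoidHom.ext fun a => ?_
  rw [MonoidHom.comp_apply, ← π_ι_mon fac (Opposite.op ⦋0⦌), ι_degZeroInv]

theorem gpMap_π_δ (p : Z ⟶ (SimplicialObject.const PrelogRing.{u}).obj Y) (n : ℕ) (j : Fin (n + 2))
    (a) : gpMap (p.app (Opposite.op ⦋n⦌)).mon (gpMap (Z.δ j).mon a) =
      gpMap (p.app (Opposite.op ⦋n + 1⦌)).mon a := by
  rw [← MonoidHom.comp_apply, ← gpMap_comp]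
  congr 2
  exact MonoidHom.ext fun q => π_map_mon p _ q

include fac in
theorem faceQuotient_mem (a) : faceQuotient hi₀ a ∈ (gpMap φ.mon).ker := by
  rw [MonoidHom.mem_ker, faceQuotient, MonoidHom.comp_apply, gpMap_φ_degZeroInv fac hi₀,
    MonoidHom.div_apply, map_div, gpMap_π_δ, gpMap_π_δ, div_self']

theorem faceQuotient_ι (q) : faceQuotient hi₀ (gpMap (i.app (Opposite.op ⦋1⦌)).mon q) = 1 := by
  rw [faceQuotient, MonoidHom.comp_apply, MonoidHom.div_apply, gpMap_δ_ι, gpMap_δ_ι, div_self',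
    map_one]

theorem ker_toT_le : (toT ((simplicialFactorisation i p fac).obj (Opposite.op ⦋1⦌))).ker ≤
    ((faceQuotient hi₀).codRestrict _ (faceQuotient_mem fac hi₀)).ker := fun g hg => by
  obtain ⟨q, rfl⟩ := exists_of_toT_eq_one _ hg
  exact Subtype.ext (faceQuotient_ι hi₀ q)

/-- The map `P₁^gp → ker (Q^gp → N^gp)`, `g ↦ δ₀(g) / δ₁(g)`, descends to `T₁`. -/
noncomputable def augTHom :
    T ((simplicialFactorisation i p fac).obj (Opposite.op ⦋1⦌)) →* GpKer φ.mon :=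
  MonoidHom.liftOfSurjective (toT ((simplicialFactorisation i p fac).obj (Opposite.op ⦋1⦌)))
    (toT_surjective _) ⟨_, ker_toT_le fac hi₀⟩

theorem augTHom_toT (g) :
    augTHom fac hi₀ (toT ((simplicialFactorisation i p fac).obj (Opposite.op ⦋1⦌)) g) =
      ⟨faceQuotient hi₀ g, faceQuotient_mem fac hi₀ g⟩ :=
  MonoidHom.liftOfRightInverse_comp_apply _ _
    (Function.rightInverse_surjInv (toT_surjective _)) _ g

/-- The augmentation `T₁ → ker (Q^gp → N^gp)`, which sends the class of `g ∈ P₁^gp` to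
`δ₀(g) / δ₁(g) ∈ P₀^gp = Q^gp`. -/
noncomputable def augT : (simplicialT (simplicialFactorisation i p fac)) _⦋1⦌ ⟶
    ModuleCat.of ℤ (Additive (GpKer φ.mon)) :=
  ModuleCat.ofHom (MonoidHom.toAdditive (augTHom fac hi₀)).toIntLinearMap

theorem augT_symT (g) : augT fac hi₀ (symT fac 1 g) =
    Additive.ofMul (⟨faceQuotient hi₀ g, faceQuotient_mem fac hi₀ g⟩ : GpKer φ.mon) :=
  congrArg Additive.ofMul (augTHom_toT fac hi₀ g)

theorem augT_surjective (hmon : Function.Surjective φ.mon) (hp : IsTrivialFibration p) :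
    Function.Surjective (augT fac hi₀) := by
  intro k
  obtain ⟨⟨k, hk⟩, rfl⟩ := Additive.ofMul.surjective k
  have hz : gpMap (p.app (Opposite.op ⦋0⦌)).mon (gpMap (i.app (Opposite.op ⦋0⦌)).mon k) = 1 := by
    rw [← gpMap_φ_degZeroInv fac hi₀ (p := p), gpMap_degZeroInv_ι]
    exact hk
  obtain ⟨w, h₀, h₁⟩ := gp_filling_zero fac hmon hp _ hz
  refine ⟨symT fac 1 w, (augT_symT fac hi₀ w).trans (congrArg Additive.ofMul (Subtype.ext ?_))⟩
  change gpMap _ (gpMap (Z.δ 0).mon w / gpMap (Z.δ 1).mon w) = k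
  rw [h₀, h₁, div_one, gpMap_degZeroInv_ι]

theorem faceQuotient_boundary (g : GrothendieckGroup (Z _⦋2⦌).mon) : faceQuotient hi₀
    (gpMap (Z.δ 0).mon g / (gpMap (Z.δ 1).mon g / gpMap (Z.δ 2).mon g)) = 1 := by
  have h₁ := gpMap_δ_δ Z (le_refl (0 : Fin 2)) g
  have h₂ := gpMap_δ_δ Z (le_refl (1 : Fin 2)) g
  have h₃ := gpMap_δ_δ Z (Fin.zero_le (1 : Fin 2)) g
  change gpMap (Z.δ 0).mon (gpMap (Z.δ 1).mon g) = gpMap (Z.δ 0).mon (gpMap (Z.δ 0).mon g) at h₁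
  change gpMap (Z.δ 1).mon (gpMap (Z.δ 2).mon g) = gpMap (Z.δ 1).mon (gpMap (Z.δ 1).mon g) at h₂
  change gpMap (Z.δ 0).mon (gpMap (Z.δ 2).mon g) = gpMap (Z.δ 1).mon (gpMap (Z.δ 0).mon g) at h₃
  rw [faceQuotient, MonoidHom.comp_apply, MonoidHom.div_apply]
  simp only [map_div, h₁, h₂, h₃]
  simp

theorem augT_objD (x : (simplicialT (simplicialFactorisation i p fac)) _⦋2⦌) :
    augT fac hi₀ (objD (simplicialT (simplicialFactorisation i p fac)) 1 x) = 0 := by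
  obtain ⟨g, rfl⟩ := symT_surjective fac _ x
  have e : objD (simplicialT (simplicialFactorisation i p fac)) 1 (symT fac 2 g) =
      symT fac 1 (gpMap (Z.δ 0).mon g / (gpMap (Z.δ 1).mon g / gpMap (Z.δ 2).mon g)) := by
    rw [objD_one_apply, symT_div, symT_div, δ_symT, δ_symT, δ_symT]
    abel
  rw [e, augT_symT]
  simp only [faceQuotient_boundary]
  rfl

/-- `T` is exact at `T₁` for the augmentation: an element of `P₁^gp` whose two faces agree can be
filled. -/
theorem exists_objD_eq_of_augT (hmon : Function.Surjective φ.mon) (hi : IsFreeCofibration i)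
    (hp : IsTrivialFibration p) (x : (simplicialT (simplicialFactorisation i p fac)) _⦋1⦌)
    (hx : augT fac hi₀ x = 0) :
    ∃ y, objD (simplicialT (simplicialFactorisation i p fac)) 1 y = x := by
  obtain ⟨g, rfl⟩ := symT_surjective fac _ x
  rw [augT_symT] at hx
  have e : gpMap (degZeroInv hi₀) (gpMap (Z.δ 0).mon g / gpMap (Z.δ 1).mon g) = 1 :=
    congrArg Subtype.val (congrArg Additive.toMul hx)
  rw [map_div, div_eq_one] at e
  obtain ⟨y, h₀, h₁⟩ := symT_filling fac hmon hi hp g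
    (gpMap (degZeroInv hi₀) (gpMap (Z.δ 0).mon g)) (fun j => by
      fin_cases j
      · exact (gpMap_ι_degZeroInv hi₀ _).symm
      · exact ((gpMap_ι_degZeroInv hi₀ _).symm.trans (congrArg _ e.symm)))
  exact ⟨y, by rw [objD_apply_of_higher_faces _ _ _ h₁, h₀]⟩

theorem projective_simplicialT (hi : IsFreeCofibration i) (n : ℕ) :
    Projective ((simplicialT (simplicialFactorisation i p fac)) _⦋n⦌) := by
  have : Module.Free ℤ ((simplicialT (simplicialFactorisation i p fac)) _⦋n⦌) :=
    free_T (E := (simplicialFactorisation i p fac).obj (Opposite.op ⦋n⦌)) (hi.isFreeOver n)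
  infer_instance
end SimplicialT

/-! ### Resolutions and scalar extension -/

section Resolutions
open AlgebraicTopology AlternatingFaceMapComplex

/-- A projective resolution from an exact complex of projective objects augmented to `K`. -/
noncomputable def CategoryTheory.ProjectiveResolution.ofExact {A : Type*} [Category* A] [Abelian A]
    (C : ChainComplex A ℕ) (hC : ∀ n, Projective (C.X n)) {K : A} (ε : C.X 0 ⟶ K) (hε : Epi ε)
    (w : C.d 1 0 ≫ ε = 0) (h₀ : (ShortComplex.mk _ _ w).Exact) (h : ∀ n, C.ExactAt (n + 1)) :
    ProjectiveResolution K where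
  complex := C
  projective := hC
  π := (ChainComplex.toSingle₀Equiv _ _).symm ⟨ε, w⟩
  quasiIso := ⟨fun n => by
    cases n
    · rw [ChainComplex.quasiIsoAt₀_iff, ShortComplex.quasiIso_iff_of_zeros']
      · refine (ShortComplex.exact_and_epi_g_iff_of_iso ?_).2 ⟨h₀, hε⟩
        exact ShortComplex.isoMk (Iso.refl _) (Iso.refl _) (Iso.refl _)
          ((Category.id_comp _).trans (Category.comp_id _).symm)
          ((Category.id_comp _).trans ((ChainComplex.toSingle₀Equiv_symm_apply_f_zero ε w).symm.trans
            (Category.comp_id _).symm))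
      · exact C.shape _ _ (by simp)
      all_goals rfl
    · rw [quasiIsoAt_iff_exactAt']
      · exact h _
      · apply ChainComplex.exactAt_succ_single_obj⟩

/-- Truncation shifts homology if the removed object is zero. In degree `0` this is not a matter of
indices, because the differential out of the last object changes. -/
noncomputable def truncateHomologyIso {A : Type*} [Category* A] [Abelian A] (C : ChainComplex A ℕ)
    (h : IsZero (C.X 0)) (n : ℕ) :
    (ChainComplex.truncate.obj C).homology n ≅ C.homology (n + 1) :=
  match n with
  | 0 => by
    let f : C.sc' 2 1 0 ⟶ (ChainComplex.truncate.obj C).sc' 1 0 0 :=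
      { τ₁ := 𝟙 (C.X 2), τ₂ := 𝟙 (C.X 1), τ₃ := 0
        comm₁₂ := (Category.id_comp _).trans (Category.comp_id _).symm
        comm₂₃ := by
          rw [comp_zero]
          exact (Category.id_comp _).trans (C.shape 1 1 (by simp)) }
    have h₁ : Epi f.τ₁ := inferInstanceAs (Epi (𝟙 (C.X 2)))
    have h₂ : IsIso f.τ₂ := inferInstanceAs (IsIso (𝟙 (C.X 1)))
    have h₃ : Mono f.τ₃ := ⟨fun _ _ _ => h.eq_of_tgt _ _⟩
    have := ShortComplex.quasiIso_of_epi_of_isIso_of_mono f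
    exact (ChainComplex.truncate.obj C).homologyIsoSc' 1 0 0 (by simp) (by simp) ≪≫
      (asIso (ShortComplex.homologyMap f)).symm ≪≫
      (C.homologyIsoSc' 2 1 0 (by simp) (by simp)).symm
  | n + 1 => (ChainComplex.truncate.obj C).homologyIsoSc' (n + 2) (n + 1) n (by simp) (by simp) ≪≫
      (C.homologyIsoSc' (n + 3) (n + 2) (n + 1) (by simp) (by simp)).symm

variable {R : Type w} [CommRing R] [IsDedekindDomain R] {B : Type u} [CommRing B]

/-- Over a Dedekind domain, a part `M₃ → M₂ → M₁` of an exact complex of torsion-free modules stays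
exact after tensoring with any module: the image of `M₁ → M₀` is torsion-free, hence flat. -/
theorem lTensor_exact_of_torsionFree {M₃ M₂ M₁ M₀ : Type*} [AddCommGroup M₃] [AddCommGroup M₂]
    [AddCommGroup M₁] [AddCommGroup M₀] [Module R M₃] [Module R M₂] [Module R M₁] [Module R M₀]
    [Module.IsTorsionFree R M₀] (d₃ : M₃ →ₗ[R] M₂)
    (d₂ : M₂ →ₗ[R] M₁) (d₁ : M₁ →ₗ[R] M₀) (h₂ : Function.Exact d₃ d₂) (h₁ : Function.Exact d₂ d₁)
    (A : Type*) [AddCommGroup A] [Module R A] :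
    Function.Exact (d₃.lTensor A) (d₂.lTensor A) := by
  have : Module.IsTorsionFree R (LinearMap.range d₁) := inferInstance
  have hinj : Function.Injective ((LinearMap.range d₂).subtype.lTensor A) := by
    refine LinearMap.lTensor_injective_of_exact_of_flat d₁.rangeRestrict
      d₁.surjective_rangeRestrict _ (Submodule.subtype_injective _) ?_ A
    intro x
    rw [← LinearMap.mem_ker, LinearMap.ker_rangeRestrict, LinearMap.mem_ker, h₁ x]
    simp
  have hex : Function.Exact (d₃.lTensor A) (d₂.rangeRestrict.lTensor A) := by
    refine lTensor_exact A ?_ d₂.surjective_rangeRestrict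
    intro x
    rw [← LinearMap.mem_ker, LinearMap.ker_rangeRestrict, LinearMap.mem_ker, h₂ x]
  have e : d₂.lTensor A = (LinearMap.range d₂).subtype.lTensor A ∘ₗ d₂.rangeRestrict.lTensor A := by
    rw [← LinearMap.lTensor_comp]
    rfl
  intro x
  rw [e, LinearMap.comp_apply, ← hex x, map_eq_zero_iff _ hinj]

theorem exact_scalarExtension_of_torsionFree {M₃ M₂ M₁ M₀ : ModuleCat.{u} R}
    (h : Module.IsTorsionFree R M₀) (f : R →+* B) (d₃ : M₃ ⟶ M₂) (d₂ : M₂ ⟶ M₁) (d₁ : M₁ ⟶ M₀)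
    (h₂ : Function.Exact d₃ d₂) (h₁ : Function.Exact d₂ d₁) :
    Function.Exact ((scalarExtension f).map d₃)
      ((scalarExtension f).map d₂) :=
  lTensor_exact_of_torsionFree d₃.hom d₂.hom d₁.hom h₂ h₁
    ((ModuleCat.restrictScalars f).obj (ModuleCat.of B B))

/-- Over a Dedekind domain, scalar extension of a complex of torsion-free modules preserves exactness
wherever the complex is exact at two successive places. -/
theorem exactAt_mapHomologicalComplex_of_torsionFree (f : R →+* B)
    (C : ChainComplex (ModuleCat.{u} R) ℕ) (n : ℕ)
    (h : Module.IsTorsionFree R (C.X n)) (h₁ : C.ExactAt (n + 1)) (h₂ : C.ExactAt (n + 2)) :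
    (((scalarExtension f).mapHomologicalComplex _).obj C).ExactAt (n + 2) := by
  rw [HomologicalComplex.exactAt_iff' _ (n + 2) (n + 1) n (by simp) (by simp),
    ShortComplex.ShortExact.moduleCat_exact_iff_function_exact] at h₁
  rw [HomologicalComplex.exactAt_iff' _ (n + 3) (n + 2) (n + 1) (by simp) (by simp),
    ShortComplex.ShortExact.moduleCat_exact_iff_function_exact] at h₂ ⊢
  exact exact_scalarExtension_of_torsionFree h f (C.d _ _) (C.d _ _) (C.d _ _) h₂ h₁

end Resolutions

/-! ### The homology of `B ⊗ T` -/

section HomologyBT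
open Algebra LogSquare AlgebraicTopology AlternatingFaceMapComplex

/-- `scalarExtension` along the structure map of an algebra is the usual base change. -/
noncomputable def scalarExtensionEquiv (R : Type w) {B : Type u} [CommRing R] [CommRing B]
    [Algebra R B] (M : ModuleCat.{u} R) :
    (scalarExtension (algebraMap R B)).obj M ≃ₗ[B] B ⊗[R] M :=
  let e : (ModuleCat.restrictScalars (algebraMap R B)).obj (ModuleCat.of B B) ≃ₗ[R] B :=
    { AddEquiv.refl B with map_smul' := fun r b => (Algebra.smul_def r (A := B) b).symm }
  let e' := TensorProduct.congr e (LinearEquiv.refl R M)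
  { e' with
    map_smul' := fun b x => by
      induction x using TensorProduct.induction_on with
      | zero =>
        exact (congrArg e' (smul_zero (A := (scalarExtension (algebraMap R B)).obj M) b)).trans
          ((map_zero e').trans ((congrArg (b • ·) (map_zero e')).trans (smul_zero b)).symm)
      | tmul a m => rfl
      | add x y hx hy =>
        exact (congrArg e' (smul_add (A := (scalarExtension (algebraMap R B)).obj M) b x y)).trans
          ((map_add e' _ _).trans ((congrArg₂ (· + ·) hx hy).trans
            ((congrArg (b • ·) (map_add e' x y)).trans (smul_add b _ _)).symm)) }

instance {B : Type u} [CommRing B] (g : ℤ →+* B) : (scalarExtension.{u, 0} g).IsLeftAdjoint :=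
  (ModuleCat.extendRestrictScalarsAdj g).isLeftAdjoint

/-- `B ⊗ T` is the scalar extension of `T` along `ℤ → B`. -/
noncomputable def functorBTIso {X Y : PrelogRing.{u}} (φ : X ⟶ Y) :
    functorT φ ⋙ scalarExtension (Int.castRingHom Y.ring) ≅ functorBT φ :=
  NatIso.ofComponents (fun E => (scalarExtensionEquiv ℤ (B := Y.ring)
    ((functorT φ).obj E)).toModuleIso) (fun {E E'} f => by
      refine ModuleCat.ExtendScalars.hom_ext fun m => ?_
      rfl)

variable {X Y : PrelogRing.{u}} {φ : X ⟶ Y} {Z : SimplicialObject PrelogRing.{u}}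
    {i : (SimplicialObject.const PrelogRing.{u}).obj X ⟶ Z}
    {p : Z ⟶ (SimplicialObject.const PrelogRing.{u}).obj Y}
    (fac : i ≫ p = (SimplicialObject.const PrelogRing.{u}).map φ)

/-- The chain complex of the simplicial abelian group `T`. -/
noncomputable def complexT : ChainComplex (ModuleCat.{u} ℤ) ℕ :=
  (alternatingFaceMapComplex _).obj (simplicialT (simplicialFactorisation i p fac))

theorem complexT_d (n : ℕ) : (complexT fac).d (n + 1) n =
    objD (simplicialT (simplicialFactorisation i p fac)) n :=
  alternatingFaceMapComplex_obj_d _ n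

theorem complexT_exactAt (hmon : Function.Surjective φ.mon) (hi : IsFreeCofibration i)
    (hp : IsTrivialFibration p) (n : ℕ) : (complexT fac).ExactAt (n + 2) :=
  exactAt_of_objD _ _ (exists_objD_eq_of_normalized _ _
    (simplicialT_normalized_filling fac hmon hi hp n))

theorem complexT_d_comp_augT (hi₀ : IsIso (i.app (Opposite.op ⦋0⦌))) :
    (ChainComplex.truncate.obj (complexT fac)).d 1 0 ≫ augT fac hi₀ = 0 :=
  ModuleCat.hom_ext (LinearMap.ext fun x =>
    (congrArg (augT fac hi₀) (DFunLike.congr_fun (congrArg ModuleCat.Hom.hom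
      (complexT_d fac 1)) x)).trans (augT_objD fac hi₀ x))

theorem complexT_exact_augT (hmon : Function.Surjective φ.mon) (hi : IsFreeCofibration i)
    (hp : IsTrivialFibration p) (hi₀ : IsIso (i.app (Opposite.op ⦋0⦌))) :
    (ShortComplex.mk _ _ (complexT_d_comp_augT fac hi₀)).Exact := by
  refine (ShortComplex.moduleCat_exact_iff _).2 fun x hx => ?_
  obtain ⟨y, hy⟩ := exists_objD_eq_of_augT fac hi₀ hmon hi hp x hx
  exact ⟨y, (DFunLike.congr_fun (congrArg ModuleCat.Hom.hom (complexT_d fac 1)) y).trans hy⟩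

/-- Since `T₀ = 0`, the complex of `T` shifted by one is a free resolution of
`ker (Q^gp → N^gp)`. -/
noncomputable def resolutionT (hmon : Function.Surjective φ.mon) (hi : IsFreeCofibration i)
    (hp : IsTrivialFibration p) (hi₀ : IsIso (i.app (Opposite.op ⦋0⦌))) :
    ProjectiveResolution (ModuleCat.of ℤ (Additive (GpKer φ.mon)) : ModuleCat.{u} ℤ) :=
  ProjectiveResolution.ofExact (ChainComplex.truncate.obj (complexT fac))
    (fun n => projective_simplicialT fac hi (n + 1)) (augT fac hi₀)
    ((ModuleCat.epi_iff_surjective _).2 (augT_surjective fac hi₀ hmon hp))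
    (complexT_d_comp_augT fac hi₀) (complexT_exact_augT fac hmon hi hp hi₀)
    (fun n => by
      have h := complexT_exactAt fac hmon hi hp n
      rw [HomologicalComplex.exactAt_iff' _ (n + 3) (n + 2) (n + 1) (by simp) (by simp)] at h
      rw [HomologicalComplex.exactAt_iff' _ (n + 2) (n + 1) n (by simp) (by simp)]
      exact h)

/-- The chain complex of `B ⊗ T` is the scalar extension of the one of `T`. -/
noncomputable def complexBTIso :
    (alternatingFaceMapComplex _).obj (simplicialBT (simplicialFactorisation i p fac)) ≅
      ((scalarExtension (Int.castRingHom Y.ring)).mapHomologicalComplex _).obj (complexT fac) :=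
  (alternatingFaceMapComplex _).mapIso
    (Functor.isoWhiskerLeft (simplicialFactorisation i p fac) (functorBTIso φ)).symm ≪≫
    (eqToIso (map_alternatingFaceMapComplex (scalarExtension (Int.castRingHom Y.ring)))).symm.app
      (simplicialT (simplicialFactorisation i p fac))

/-- `H_{n + 1}(B ⊗ T) ≅ Tor_n^ℤ(ker (Q^gp → N^gp), B)` -/
noncomputable def homologyBTIsoTor (hmon : Function.Surjective φ.mon) (hi : IsFreeCofibration i)
    (hp : IsTrivialFibration p) (hi₀ : IsIso (i.app (Opposite.op ⦋0⦌))) (n : ℕ) :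
    (simplicialHomology Y.ring (n + 1)).obj (simplicialBT (simplicialFactorisation i p fac)) ≅
      torModule (Int.castRingHom Y.ring) (ModuleCat.of ℤ (Additive (GpKer φ.mon))) n :=
  (HomologicalComplex.homologyFunctor _ _ (n + 1)).mapIso (complexBTIso fac) ≪≫
    (truncateHomologyIso _ (by
      have h : IsZero ((simplicialT (simplicialFactorisation i p fac)) _⦋0⦌) := by
        rw [ModuleCat.isZero_iff_subsingleton]
        exact ⟨fun x y => (simplicialT_zero fac hi₀ x).trans (simplicialT_zero fac hi₀ y).symm⟩
      exact Functor.map_isZero (scalarExtension (Int.castRingHom Y.ring)) h) n).symm ≪≫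
    ((resolutionT fac hmon hi hp hi₀).isoLeftDerivedObj
      (scalarExtension (Int.castRingHom Y.ring)) n).symm

/-- Since `T` is exact in degrees `≥ 2` and torsion-free, `B ⊗ T` is exact in degrees `≥ 3`. -/
theorem isZero_homologyBT (hmon : Function.Surjective φ.mon) (hi : IsFreeCofibration i)
    (hp : IsTrivialFibration p) (n : ℕ) : IsZero ((simplicialHomology Y.ring (n + 3)).obj
    (simplicialBT (simplicialFactorisation i p fac))) := by
  refine IsZero.of_iso ?_
    ((HomologicalComplex.homologyFunctor _ _ (n + 3)).mapIso (complexBTIso fac))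
  have : Module.Free ℤ ((complexT fac).X (n + 1)) :=
    free_T (E := (simplicialFactorisation i p fac).obj (Opposite.op ⦋n + 1⦌)) (hi.isFreeOver (n + 1))
  exact (exactAt_mapHomologicalComplex_of_torsionFree _ _ (n + 1) inferInstance
    (complexT_exactAt fac hmon hi hp n)
    (complexT_exactAt fac hmon hi hp (n + 1))).isZero_homology

/-- `H_{n + 1}(B ⊗ T) ≅ W_{n + 1}` -/
noncomputable def homologyBTIso (hmon : Function.Surjective φ.mon) (hi : IsFreeCofibration i)
    (hp : IsTrivialFibration p) (hi₀ : IsIso (i.app (Opposite.op ⦋0⦌))) (n : ℕ) :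
    (simplicialHomology Y.ring (n + 1)).obj (simplicialBT (simplicialFactorisation i p fac)) ≅
      termW Y.ring φ.mon (n + 1) :=
  match n with
  | 0 => homologyBTIsoTor fac hmon hi hp hi₀ 0 ≪≫
      ((scalarExtension (Int.castRingHom Y.ring)).leftDerivedZeroIsoSelf.app _) ≪≫
      (scalarExtensionEquiv ℤ (B := Y.ring)
        (ModuleCat.of ℤ (Additive (GpKer φ.mon)))).toModuleIso
  | 1 => homologyBTIsoTor fac hmon hi hp hi₀ 1
  | n + 2 => (isZero_homologyBT fac hmon hi hp n).iso
      (ModuleCat.isZero_of_subsingleton (ModuleCat.of Y.ring PUnit.{u + 1}))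
end HomologyBT

/-! ### The homology of `I` -/

namespace LogSquare

/-- The `B`-module structure of `R ⊗_C B`, over the additive group that underlies the ring: instance
search does not see through the definition of that ring to find it from the `B`-algebra structure. -/
noncomputable instance {C R B : Type u} [CommRing C] [CommRing R] [CommRing B] (f : C →+* R)
    (g : C →+* B) : @Module B (RingPushout f g) _ Ring.toAddCommGroup.toAddCommMonoid :=
  Algebra.toModule

variable {X Y : PrelogRing.{u}}

/-- The functor `(R, P) ↦ R`, with values in `C`-modules. -/
noncomputable def functorR (φ : X ⟶ Y) : Factorisation φ ⥤ ModuleCat.{u} X.ring where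
  obj E := (ModuleCat.restrictScalars E.ι.ring).obj (ModuleCat.of E.mid.ring E.mid.ring)
  map {E E'} f := ModuleCat.ofHom
    (X := (ModuleCat.restrictScalars E.ι.ring).obj (ModuleCat.of E.mid.ring E.mid.ring))
    (Y := (ModuleCat.restrictScalars E'.ι.ring).obj (ModuleCat.of E'.mid.ring E'.mid.ring))
    { toFun := f.h.ring
      map_add' := map_add f.h.ring
      map_smul' := fun c r => (map_mul f.h.ring (E.ι.ring c) r).trans
        (congrArg (· * f.h.ring r) (RingHom.congr_fun (ι_h_ring f) c)) }

/-- The functor `(R, P) ↦ R ⊗_C B`, with values in `B`-modules. -/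
noncomputable def functorA (φ : X ⟶ Y) : Factorisation φ ⥤ ModuleCat.{u} Y.ring where
  obj E := ModuleCat.of Y.ring (A E)
  map {E E'} f := ModuleCat.ofHom
    { toFun := mapA f
      map_add' := map_add (mapA f)
      map_smul' := fun b x => by
        change mapA f (RingPushout.inr _ _ b * x) = RingPushout.inr _ _ b * mapA f x
        rw [map_mul, mapA_inr] }
  map_id E := by
    ext x
    exact RingHom.congr_fun mapA_id x
  map_comp f g := by
    ext x
    exact RingHom.congr_fun (mapA_comp f g) x

/-- The identification of `B ⊗_C R` with `R ⊗_C B`. -/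
noncomputable def scalarExtensionEquivPushout {C R B : Type u} [CommRing C] [CommRing R]
    [CommRing B] (f : C →+* R) (g : C →+* B) :
    (scalarExtension g).obj ((ModuleCat.restrictScalars f).obj (ModuleCat.of R R)) ≃ₗ[B]
      RingPushout f g := by
  letI := f.toAlgebra
  letI := g.toAlgebra
  letI e : B ⊗[C] R ≃ₗ[C] R ⊗[C] B := TensorProduct.comm C B R
  letI F : (scalarExtension g).obj ((ModuleCat.restrictScalars f).obj (ModuleCat.of R R)) ≃+
      RingPushout f g := e.toAddEquiv
  refine { F with
    map_smul' := fun b x => ?_ }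
  have h (a : B) (m : R) :
      (m ⊗ₜ[C] (b * a) : R ⊗[C] B) = (Algebra.TensorProduct.includeRight b : R ⊗[C] B) * m ⊗ₜ[C] a :=
    (congrArg (fun r : R => r ⊗ₜ[C] (b * a)) (one_mul m).symm).trans
      (Algebra.TensorProduct.tmul_mul_tmul 1 m b a).symm
  change F (b • x) = RingPushout.inr f g b * F x
  induction x using TensorProduct.induction_on with
  | zero =>
    exact (congrArg F (smul_zero (A := (scalarExtension g).obj
      ((ModuleCat.restrictScalars f).obj (ModuleCat.of R R))) b)).trans ((map_zero F).trans
      ((congrArg (RingPushout.inr f g b * ·) (map_zero F)).trans (mul_zero _)).symm)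
  | tmul a m => exact h a m
  | add x y hx hy =>
    exact (congrArg F (smul_add (A := (scalarExtension g).obj
      ((ModuleCat.restrictScalars f).obj (ModuleCat.of R R))) b x y)).trans ((map_add F _ _).trans
      ((congrArg₂ (· + ·) hx hy).trans
        ((congrArg (RingPushout.inr f g b * ·) (map_add F x y)).trans (mul_add _ _ _)).symm))

/-- `R ⊗_C B` is the scalar extension of `R` along `C → B`. -/
noncomputable def functorAIso (φ : X ⟶ Y) :
    functorR φ ⋙ scalarExtension φ.ring ≅ functorA φ :=
  NatIso.ofComponents (fun E => (scalarExtensionEquivPushout E.ι.ring φ.ring).toModuleIso)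
    (fun {E E'} f => by
      refine ModuleCat.ExtendScalars.hom_ext fun m => ?_
      refine Eq.symm ?_
      change mapA f (RingPushout.inl _ _ m) = RingPushout.inl _ _ (f.h.ring m)
      exact RingPushout.desc_inl _ _ _ _)

end LogSquare

section HomologyI
open Algebra LogSquare AlgebraicTopology AlternatingFaceMapComplex

variable {X Y : PrelogRing.{u}} {φ : X ⟶ Y} {Z : SimplicialObject PrelogRing.{u}}
    {i : (SimplicialObject.const PrelogRing.{u}).obj X ⟶ Z}
    {p : Z ⟶ (SimplicialObject.const PrelogRing.{u}).obj Y}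
    (fac : i ≫ p = (SimplicialObject.const PrelogRing.{u}).map φ)

/-- The simplicial `C`-module `R`. -/
noncomputable def simplicialR (F : SimplicialObject (Factorisation φ)) :
    SimplicialObject (ModuleCat.{u} X.ring) :=
  F ⋙ functorR φ

/-- The simplicial `B`-module `R ⊗_C B`. -/
noncomputable def simplicialA (F : SimplicialObject (Factorisation φ)) :
    SimplicialObject (ModuleCat.{u} Y.ring) :=
  F ⋙ functorA φ

theorem π_map_ring (p : Z ⟶ (SimplicialObject.const PrelogRing.{u}).obj Y)
    {m m' : SimplexCategoryᵒᵖ} (θ : m ⟶ m') (a : (Z.obj m).ring) :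
    (p.app m').ring ((Z.map θ).ring a) = (p.app m).ring a :=
  DFunLike.congr_fun (congrArg PrelogRing.Hom.ring (p.naturality θ)) a

/-- If `x ∈ R_n` maps to zero in `B` and has zero boundary, it is the `0`-th face of an element of
which the other faces are zero. -/
theorem ring_filling_of_sameBoundary (hp : IsTrivialFibration p) {n : ℕ} (x : (Z _⦋n⦌).ring)
    (h : SameBoundary (K := Z ⋙ PrelogRing.forgetRing) x (0 : (Z _⦋n⦌).ring))
    (hx : (p.app _).ring x = 0) :
    ∃ y : (Z _⦋n + 1⦌).ring, (Z.δ 0).ring y = x ∧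
      ∀ j : Fin (n + 1), (Z.δ j.succ).ring y = 0 := by
  obtain ⟨y, h₀, h₁⟩ : ∃ y : (Z _⦋n + 1⦌).ring, (Z.δ 0).ring y = x ∧
      ∀ j : Fin (n + 1), (Z.δ j.succ).ring y = (Z.δ j.succ).ring 0 :=
    exists_replace_face_zero _ hp.1 (n := n) (0 : (Z _⦋n + 1⦌).ring) x
    (by
      change SameBoundary (K := Z ⋙ PrelogRing.forgetRing) x ((Z.δ 0).ring 0)
      rwa [map_zero])
    (by
      change (p.app _).ring x = (p.app _).ring ((Z.δ 0).ring 0)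
      rw [map_zero, map_zero, hx])
  exact ⟨y, h₀, fun j => (h₁ j).trans (map_zero _)⟩

theorem simplicialR_normalized_filling (hp : IsTrivialFibration p) (n : ℕ)
    (x : (simplicialR (simplicialFactorisation i p fac)) _⦋n + 1⦌)
    (hx : ∀ j, (simplicialR (simplicialFactorisation i p fac)).δ j x = 0) :
    ∃ y : (simplicialR (simplicialFactorisation i p fac)) _⦋n + 2⦌,
      (simplicialR (simplicialFactorisation i p fac)).δ 0 y = x ∧
      ∀ j : Fin (n + 2), (simplicialR (simplicialFactorisation i p fac)).δ j.succ y = 0 := by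
  have hx' : ∀ j, (Z.δ j).ring (x : (Z _⦋n + 1⦌).ring) = 0 := hx
  refine ring_filling_of_sameBoundary hp (n := n + 1) x
    (SameBoundary.of_δ _ _ fun j => (hx' j).trans (map_zero (Z.δ j).ring).symm) ?_
  refine (π_map_ring p (SimplexCategory.δ (n := n) 0).op x).symm.trans ?_
  exact (congrArg _ (hx' 0)).trans (map_zero _)

/-- The chain complex of the simplicial module `R`. -/
noncomputable def complexR : ChainComplex (ModuleCat.{u} X.ring) ℕ :=
  (alternatingFaceMapComplex _).obj (simplicialR (simplicialFactorisation i p fac))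

theorem complexR_d (n : ℕ) : (complexR fac).d (n + 1) n =
    objD (simplicialR (simplicialFactorisation i p fac)) n :=
  alternatingFaceMapComplex_obj_d _ n

theorem complexR_exactAt (hp : IsTrivialFibration p) (n : ℕ) :
    (complexR fac).ExactAt (n + 1) :=
  exactAt_of_objD _ _ (exists_objD_eq_of_normalized _ _ (simplicialR_normalized_filling fac hp n))

theorem complexR_d_apply (x : (Z _⦋1⦌).ring) : (complexR fac).d 1 0 x =
    ((Z.δ 0).ring x - (Z.δ 1).ring x : (Z _⦋0⦌).ring) := by
  refine (DFunLike.congr_fun (congrArg ModuleCat.Hom.hom (complexR_d fac 0)) x).trans ?_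
  refine (objD_apply (simplicialR (simplicialFactorisation i p fac)) 0 x).trans ?_
  rw [Fin.sum_univ_two]
  simp only [Fin.val_zero, pow_zero, one_smul, Fin.val_one, pow_one, neg_smul]
  exact (sub_eq_add_neg _ _).symm

/-- `R_n` is a polynomial ring over `C`, hence a free `C`-module. -/
theorem projective_simplicialR (hi : IsFreeCofibration i) (n : ℕ) :
    Projective ((complexR fac).X n) := by
  obtain ⟨V, W, -, h, -⟩ := hi
  let e := RingEquiv.ofBijective _ (h n)
  let e' : MvPolynomial (V n ⊕ W n) X.ring ≃ₗ[X.ring] (complexR fac).X n :=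
    { e.toAddEquiv with
      map_smul' := fun c x => (congrArg e (MvPolynomial.smul_eq_C_mul x c)).trans
        ((map_mul e _ _).trans (congrArg (· * e x) (MvPolynomial.eval₂Hom_C _ _ c))) }
  have : Module.Free X.ring ((complexR fac).X n) := Module.Free.of_equiv e'
  infer_instance

/-- The augmentation `R₀ → B`. -/
noncomputable def augR : (complexR fac).X 0 ⟶
    (ModuleCat.restrictScalars φ.ring).obj (ModuleCat.of Y.ring Y.ring) :=
  ModuleCat.ofHom
    (X := (simplicialR (simplicialFactorisation i p fac)) _⦋0⦌)
    (Y := (ModuleCat.restrictScalars φ.ring).obj (ModuleCat.of Y.ring Y.ring))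
    { toFun := (p.app (Opposite.op ⦋0⦌)).ring
      map_add' := map_add (p.app (Opposite.op ⦋0⦌)).ring
      map_smul' := fun c r => (map_mul (p.app (Opposite.op ⦋0⦌)).ring
          ((i.app (Opposite.op ⦋0⦌)).ring c) r).trans
        (congrArg (fun b : ((SimplicialObject.const PrelogRing.{u}).obj Y _⦋0⦌).ring =>
          b * (p.app (Opposite.op ⦋0⦌)).ring r)
          (RingHom.congr_fun (ring_fac ((simplicialFactorisation i p fac).obj (Opposite.op ⦋0⦌))) c)) }

theorem augR_surjective (hring : Function.Surjective φ.ring) :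
    Function.Surjective (augR fac) := fun b => by
  obtain ⟨c, rfl⟩ := hring b
  exact ⟨(i.app _).ring c,
    RingHom.congr_fun (ring_fac ((simplicialFactorisation i p fac).obj (Opposite.op ⦋0⦌))) c⟩

theorem complexR_d_comp_augR : (complexR fac).d 1 0 ≫ augR fac = 0 :=
  ModuleCat.hom_ext (LinearMap.ext fun x => by
    refine (congrArg (augR fac) (complexR_d_apply fac x)).trans ?_
    change (p.app (Opposite.op ⦋0⦌)).ring ((Z.δ 0).ring _ - (Z.δ 1).ring _) = 0
    rw [map_sub, sub_eq_zero]
    exact (π_map_ring p (SimplexCategory.δ 0).op x).trans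
      (π_map_ring p (SimplexCategory.δ 1).op x).symm)

theorem complexR_exact_augR (hp : IsTrivialFibration p) :
    (ShortComplex.mk _ _ (complexR_d_comp_augR fac)).Exact := by
  refine (ShortComplex.moduleCat_exact_iff _).2 fun x hx => ?_
  obtain ⟨y, h₀, h₁⟩ := ring_filling_of_sameBoundary hp (n := 0) x (SameBoundary.of_dim_zero _ _) hx
  refine ⟨y, (complexR_d_apply fac y).trans ?_⟩
  exact (congrArg₂ (fun a b : (Z _⦋0⦌).ring => a - b) h₀ (h₁ 0)).trans (sub_zero _)

/-- `R` is a free resolution of the `C`-module `B`. -/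
noncomputable def resolutionR (hring : Function.Surjective φ.ring) (hi : IsFreeCofibration i)
    (hp : IsTrivialFibration p) :
    ProjectiveResolution ((ModuleCat.restrictScalars φ.ring).obj (ModuleCat.of Y.ring Y.ring)) :=
  ProjectiveResolution.ofExact (complexR fac) (projective_simplicialR fac hi) (augR fac)
    ((ModuleCat.epi_iff_surjective _).2 (augR_surjective fac hring))
    (complexR_d_comp_augR fac) (complexR_exact_augR fac hp) (complexR_exactAt fac hp)

/-- The chain complex of `R ⊗_C B` is the scalar extension of the one of `R`. -/
noncomputable def complexAIso :
    (alternatingFaceMapComplex _).obj (simplicialA (simplicialFactorisation i p fac)) ≅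
      ((scalarExtension φ.ring).mapHomologicalComplex _).obj (complexR fac) :=
  (alternatingFaceMapComplex _).mapIso
    (Functor.isoWhiskerLeft (simplicialFactorisation i p fac) (functorAIso φ)).symm ≪≫
    (eqToIso (map_alternatingFaceMapComplex (scalarExtension φ.ring))).symm.app
      (simplicialR (simplicialFactorisation i p fac))

/-- `H_n(R ⊗_C B) ≅ Tor_n^C(B, B)` -/
noncomputable def homologyAIso (hring : Function.Surjective φ.ring) (hi : IsFreeCofibration i)
    (hp : IsTrivialFibration p) (n : ℕ) :
    (simplicialHomology Y.ring n).obj (simplicialA (simplicialFactorisation i p fac)) ≅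
      torSelf φ.ring n :=
  (HomologicalComplex.homologyFunctor _ _ n).mapIso (complexAIso fac) ≪≫
    ((resolutionR fac hring hi hp).isoLeftDerivedObj (scalarExtension φ.ring) n).symm

/-- The inclusion `I → R ⊗_C B`. -/
noncomputable def natInclusionI (φ : X ⟶ Y) : functorI φ ⟶ functorA φ where
  app E := ModuleCat.ofHom
    { toFun := fun x => x.1
      map_add' := fun _ _ => rfl
      map_smul' := fun _ _ => rfl }

/-- The augmentation `R ⊗_C B → B`. -/
noncomputable def natAugA (φ : X ⟶ Y) :
    functorA φ ⟶ (Functor.const _).obj (ModuleCat.of Y.ring Y.ring) where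
  app E := ModuleCat.ofHom
    { toFun := augA E
      map_add' := map_add (augA E)
      map_smul' := fun b x => (map_mul (augA E) _ _).trans (by rw [augA_inr]; rfl) }
  naturality _ _ f := by
    ext x
    exact RingHom.congr_fun (augA_mapA f) x

/-- The section `B → R ⊗_C B` of the augmentation. -/
noncomputable def natInrA (φ : X ⟶ Y) :
    (Functor.const _).obj (ModuleCat.of Y.ring Y.ring) ⟶ functorA φ where
  app E := ModuleCat.ofHom
    { toFun := RingPushout.inr E.ι.ring φ.ring
      map_add' := map_add _
      map_smul' := fun b x => map_mul (RingPushout.inr E.ι.ring φ.ring) b x }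
  naturality _ _ f := by
    ext
    exact (mapA_inr f _).symm

/-- The projection `R ⊗_C B → I` along `B`. -/
noncomputable def natRetractionI (φ : X ⟶ Y) : functorA φ ⟶ functorI φ where
  app E := ModuleCat.ofHom
    { toFun := fun x => ⟨x - RingPushout.inr E.ι.ring φ.ring (augA E x), by
        rw [RingHom.mem_ker, map_sub, augA_inr, sub_self]⟩
      map_add' := fun x y => Subtype.ext (by
        change x + y - _ = (x - _) + (y - _)
        rw [map_add, map_add]
        abel)
      map_smul' := fun b x => Subtype.ext (by
        change RingPushout.inr _ _ b * x - RingPushout.inr _ _ (augA E (RingPushout.inr _ _ b * x))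
          = RingPushout.inr _ _ b * (x - RingPushout.inr _ _ (augA E x))
        rw [map_mul, augA_inr, map_mul, mul_sub]) }
  naturality E E' f := by
    ext x
    have h (x : A E) : mapA f x - RingPushout.inr _ _ (augA E' (mapA f x)) =
        mapA f (x - RingPushout.inr _ _ (augA E x)) := by
      rw [map_sub, mapA_inr, ← RingHom.comp_apply (augA E'), augA_mapA]
    exact Subtype.ext (h x)

theorem natInclusionI_retraction (φ : X ⟶ Y) : natInclusionI φ ≫ natRetractionI φ = 𝟙 _ := by
  ext E x
  refine Subtype.ext ?_
  have h : augA E x.1 = 0 := x.2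
  change x.1 - RingPushout.inr _ _ (augA E x.1) = x.1
  rw [h, map_zero, sub_zero]

theorem natRetractionI_inclusion (φ : X ⟶ Y) :
    natRetractionI φ ≫ natInclusionI φ = 𝟙 _ - natAugA φ ≫ natInrA φ := by
  ext E x
  rfl

instance (B : Type u) [CommRing B] (n : ℕ) : (simplicialHomology B n).Additive := by
  unfold simplicialHomology
  infer_instance

/-- The inclusion `I → R ⊗_C B` induces isomorphisms of the homology in positive degrees, since
its cokernel is the constant module `B`. -/
noncomputable def homologyIIsoA (F : SimplicialObject (Factorisation φ)) (n : ℕ) :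
    (simplicialHomology Y.ring (n + 1)).obj (simplicialI F) ≅
      (simplicialHomology Y.ring (n + 1)).obj (simplicialA F) where
  hom := (simplicialHomology Y.ring (n + 1)).map (Functor.whiskerLeft F (natInclusionI φ))
  inv := (simplicialHomology Y.ring (n + 1)).map (Functor.whiskerLeft F (natRetractionI φ))
  hom_inv_id := by
    have e : Functor.whiskerLeft F (natInclusionI φ) ≫ Functor.whiskerLeft F (natRetractionI φ) =
        𝟙 (simplicialI F) := by
      rw [← Functor.whiskerLeft_comp, natInclusionI_retraction]
      rfl
    exact (Functor.map_comp _ _ _).symm.trans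
      ((congrArg _ e).trans (CategoryTheory.Functor.map_id _ _))
  inv_hom_id := by
    let f : simplicialA F ⟶ (SimplicialObject.const _).obj (ModuleCat.of Y.ring Y.ring) :=
      Functor.whiskerLeft F (natAugA φ)
    let g : (SimplicialObject.const _).obj (ModuleCat.of Y.ring Y.ring) ⟶ simplicialA F :=
      Functor.whiskerLeft F (natInrA φ)
    have e : Functor.whiskerLeft F (natRetractionI φ) ≫ Functor.whiskerLeft F (natInclusionI φ) =
        𝟙 (simplicialA F) - f ≫ g := by
      rw [← Functor.whiskerLeft_comp, natRetractionI_inclusion]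
      rfl
    refine (Functor.map_comp _ _ _).symm.trans ((congrArg _ e).trans ?_)
    rw [Functor.map_sub, Functor.map_comp, CategoryTheory.Functor.map_id,
      (isZero_homology_const (ModuleCat.of Y.ring Y.ring) n).eq_of_tgt
        ((simplicialHomology Y.ring (n + 1)).map f) 0, zero_comp, sub_zero]

/-- `H_{n + 1}(I) ≅ Tor_{n + 1}^C(B, B)` -/
noncomputable def homologyIIso (hring : Function.Surjective φ.ring) (hi : IsFreeCofibration i)
    (hp : IsTrivialFibration p) (n : ℕ) :
    (simplicialHomology Y.ring (n + 1)).obj (simplicialI (simplicialFactorisation i p fac)) ≅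
      torSelf φ.ring (n + 1) :=
  homologyIIsoA _ n ≪≫ homologyAIso fac hring hi hp (n + 1)

end HomologyI

/-! ### Injectivity of `α` -/

@[elab_as_elim]
theorem RingPushout.induction_on {C R B : Type u} [CommRing C] [CommRing R] [CommRing B]
    {f : C →+* R} {g : C →+* B} {p : RingPushout f g → Prop} (x : RingPushout f g)
    (mul : ∀ r b, p (inl f g r * inr f g b)) (add : ∀ x y, p x → p y → p (x + y)) : p x := by
  let := f.toAlgebra
  let := g.toAlgebra
  have h (r : R) (b : B) : (r ⊗ₜ[C] b : RingPushout f g) = inl f g r * inr f g b :=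
    ((Algebra.TensorProduct.tmul_mul_tmul r 1 1 b).trans (by simp)).symm
  refine TensorProduct.induction_on x ?_ (fun r b => h r b ▸ mul r b) add
  have h₀ := mul 0 0
  rwa [map_zero, zero_mul] at h₀

namespace LogSquare

section Injectivity

variable {X Y : PrelogRing.{u}} {φ : X ⟶ Y} (E : Factorisation φ)

/-- `p ↦ p ⊗ 1` -/
noncomputable def inlS : MonoidAlgebra ℤ E.mid.mon →+* S E := RingPushout.inl _ _

/-- `n ↦ 1 ⊗ n` -/
noncomputable def inrS : MonoidAlgebra ℤ Y.mon →+* S E := RingPushout.inr _ _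

theorem augS_inrS (y) : augS E (inrS E y) = y := RingPushout.desc_inr _ _ _ _

theorem toA_inlS (p) : toA E (inlS E (MonoidAlgebra.single p 1)) =
    RingPushout.inl _ _ (E.mid.α p) := by
  rw [toA, inlS, RingPushout.desc_inl, RingHom.comp_apply, monoidRingLift_single, one_smul]

theorem toA_inrS (n) : toA E (inrS E (MonoidAlgebra.single n 1)) =
    RingPushout.inr _ _ (Y.α n) := by
  rw [toA, inrS, RingPushout.desc_inr, RingHom.comp_apply, monoidRingLift_single, one_smul]

theorem inlS_ι (q) : inlS E (MonoidAlgebra.single (E.ι.mon q) 1) =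
    inrS E (MonoidAlgebra.single (φ.mon q) 1) := by
  have h := RingHom.congr_fun (RingPushout.condition (MonoidAlgebra.mapDomainRingHom ℤ E.ι.mon)
    (MonoidAlgebra.mapDomainRingHom ℤ φ.mon)) (MonoidAlgebra.single q 1)
  simpa [inlS, inrS] using h

/-- The ring `ℤ[P] ⊗_{ℤ[Q]} ℤ[N]` is generated by the elements of `P ⊕_Q N` as an additive
group. -/
theorem S_addHom_ext {G : Type*} [AddCommGroup G] {F F' : S E →+ G}
    (h : ∀ p n, F (inlS E (MonoidAlgebra.single p 1) *
        inrS E (MonoidAlgebra.single n 1)) =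
      F' (inlS E (MonoidAlgebra.single p 1) *
        inrS E (MonoidAlgebra.single n 1))) : F = F' := by
  have h₁ (x : MonoidAlgebra ℤ E.mid.mon) (n) :
      F (inlS E x * inrS E (MonoidAlgebra.single n 1)) =
        F' (inlS E x * inrS E (MonoidAlgebra.single n 1)) := by
    induction x using MonoidAlgebra.induction_linear with
    | zero => simp
    | add x y hx hy => rw [map_add, add_mul, map_add, map_add, hx, hy]
    | single p k =>
      have e : MonoidAlgebra.single p k = k • MonoidAlgebra.single p (1 : ℤ) := by simp
      rw [e, map_zsmul, smul_mul_assoc, map_zsmul, map_zsmul, h]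
  have h₂ (x : MonoidAlgebra ℤ E.mid.mon) (y : MonoidAlgebra ℤ Y.mon) :
      F (inlS E x * inrS E y) =
        F' (inlS E x * inrS E y) := by
    induction y using MonoidAlgebra.induction_linear with
    | zero => simp
    | add y y' hy hy' => rw [map_add, mul_add, map_add, map_add, hy, hy']
    | single n k =>
      have e : MonoidAlgebra.single n k = k • MonoidAlgebra.single n (1 : ℤ) := by simp
      rw [e, map_zsmul, mul_smul_comm, map_zsmul, map_zsmul, h₁]
  ext x
  exact RingPushout.induction_on (p := fun x => F x = F' x) x
    (fun a b => h₂ a b) (fun x y hx hy => by rw [map_add, map_add, hx, hy])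

variable (V : Set E.mid.mon) (W : Set E.mid.ring)

/-- The homomorphism `B[V ⊔ W] → R ⊗_C B`. -/
noncomputable def polyToA : MvPolynomial (V ⊕ W) Y.ring →+* A E :=
  MvPolynomial.eval₂Hom (RingPushout.inr E.ι.ring φ.ring)
    (Sum.elim (fun v => RingPushout.inl E.ι.ring φ.ring (E.mid.α v))
      (fun z => RingPushout.inl E.ι.ring φ.ring z))

/-- A monomial in the elements of `V`, as an element of `P`. -/
noncomputable def monV (a : V →₀ ℕ) : E.mid.mon := a.prod fun v k => (v : E.mid.mon) ^ k

/-- A monomial in the elements of `W`, as an element of `R ⊗_C B`. -/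
noncomputable def monW (a : W →₀ ℕ) : A E :=
  a.prod fun z k => RingPushout.inl E.ι.ring φ.ring (z : E.mid.ring) ^ k

theorem polyToA_monomial (a : V →₀ ℕ) (e : W →₀ ℕ) (b : Y.ring) :
    polyToA E V W (MvPolynomial.monomial (Finsupp.sumElim a e) b) =
      RingPushout.inr _ _ b * monW E W e *
        toA E (inlS E (MonoidAlgebra.single (monV E V a) 1)) := by
  have h : toA E (inlS E (MonoidAlgebra.single (monV E V a) 1)) =
      a.prod fun v k => RingPushout.inl E.ι.ring φ.ring (E.mid.α v) ^ k := by
    rw [toA_inlS, monV, map_finsuppProd, map_finsuppProd]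
    simp only [map_pow]
  rw [h, polyToA, MvPolynomial.coe_eval₂Hom, MvPolynomial.eval₂_monomial, mul_assoc]
  congr 1
  rw [Finsupp.prod_sumElim, mul_comm]
  rfl

variable (hW : Function.Bijective (MvPolynomial.eval₂Hom E.ι.ring
  (Sum.elim (fun v : V => E.mid.α v) (fun z : W => (z : E.mid.ring)))))

include hW in
theorem polyToA_surjective : Function.Surjective (polyToA E V W) := by
  have h₁ (r : E.mid.ring) : RingPushout.inl E.ι.ring φ.ring r ∈ (polyToA E V W).range := by
    obtain ⟨f, rfl⟩ := hW.2 r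
    refine ⟨MvPolynomial.map φ.ring f, RingHom.congr_fun
      (f := (polyToA E V W).comp (MvPolynomial.map φ.ring))
      (g := (RingPushout.inl E.ι.ring φ.ring).comp _) ?_ f⟩
    refine MvPolynomial.ringHom_ext (fun c => ?_) (fun s => ?_)
    · simpa [polyToA] using (RingHom.congr_fun (RingPushout.condition E.ι.ring φ.ring) c).symm
    · cases s <;> simp [polyToA]
  intro x
  change x ∈ (polyToA E V W).range
  exact RingPushout.induction_on (p := fun x => x ∈ (polyToA E V W).range) x
    (fun a b => mul_mem (h₁ a) ⟨MvPolynomial.C b, MvPolynomial.eval₂Hom_C _ _ b⟩) (fun x y => add_mem)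

/-- The inverse `R ⊗_C B → B[V ⊔ W]` of `polyToA`, if `R = C[V ⊔ W]`. -/
noncomputable def polyOfA : A E →+* MvPolynomial (V ⊕ W) Y.ring :=
  RingPushout.desc
    ((MvPolynomial.map φ.ring).comp (RingEquiv.ofBijective _ hW).symm.toRingHom)
    MvPolynomial.C (by
      ext1 c
      have h : (RingEquiv.ofBijective _ hW).symm (E.ι.ring c) = MvPolynomial.C c := by
        rw [RingEquiv.symm_apply_eq]
        exact (MvPolynomial.eval₂Hom_C _ _ c).symm
      change MvPolynomial.map φ.ring ((RingEquiv.ofBijective _ hW).symm (E.ι.ring c)) = _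
      rw [h, MvPolynomial.map_C]
      rfl)

theorem polyOfA_polyToA (f) : polyOfA E V W hW (polyToA E V W f) = f := by
  refine RingHom.congr_fun (f := (polyOfA E V W hW).comp (polyToA E V W)) (g := RingHom.id _) ?_ f
  have h (s) : (RingEquiv.ofBijective _ hW).symm (Sum.elim (fun v : V => E.mid.α v)
      (fun z : W => (z : E.mid.ring)) s) = MvPolynomial.X s := by
    rw [RingEquiv.symm_apply_eq]
    exact (MvPolynomial.eval₂Hom_X' _ _ s).symm
  refine MvPolynomial.ringHom_ext (fun b => ?_) (fun s => ?_)
  · simp [polyToA, polyOfA]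
  · have e : polyToA E V W (MvPolynomial.X s) = RingPushout.inl E.ι.ring φ.ring
        (Sum.elim (fun v : V => E.mid.α v) (fun z : W => (z : E.mid.ring)) s) := by
      cases s <;> simp [polyToA]
    rw [RingHom.comp_apply, e, polyOfA, RingPushout.desc_inl]
    refine (congrArg (MvPolynomial.map φ.ring) (h s)).trans (MvPolynomial.map_X _ _)

/-- The additive projection of `ℤ[P] ⊗_{ℤ[Q]} ℤ[N]` onto `J` along `ℤ[N]`. -/
noncomputable def projJ : S E →+ J E where
  toFun s := ⟨s - inrS E (augS E s), by
    rw [RingHom.mem_ker, map_sub, augS_inrS, sub_self]⟩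
  map_zero' := Subtype.ext (by simp)
  map_add' s t := Subtype.ext (by
    change s + t - inrS E (augS E (s + t)) = (s - inrS E (augS E s)) + (t - inrS E (augS E t))
    rw [map_add, map_add]
    abel)

theorem projJ_inr_mul (y : MonoidAlgebra ℤ Y.mon) (s : S E) :
    projJ E (inrS E y * s) =
      inrS E y • projJ E s := Subtype.ext (by
  change inrS E y * s - inrS E (augS E (inrS E y * s)) = inrS E y * (s - inrS E (augS E s))
  rw [map_mul, augS_inrS, map_mul, mul_sub])

theorem projJ_mul (s : S E) (j : J E) : projJ E (s * j) = s • j := Subtype.ext (by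
  have h : augS E (s * j) = 0 := (J E).mul_mem_left s j.2
  change s * (j : S E) - inrS E (augS E (s * j)) = s * (j : S E)
  rw [h, map_zero, sub_zero])

/-- The map `B[V ⊔ W] → U` that sends a monomial `b v w` to
`b w ⊗ (v - v')`, where `v'` is the image of `v` in `N`. -/
noncomputable def polyToU : MvPolynomial (V ⊕ W) Y.ring →ₗ[Y.ring] U E :=
  (MvPolynomial.basisMonomials (V ⊕ W) Y.ring).constr Y.ring fun m =>
    IdealBaseChange.tmul (toA E) (J E)
      (monW E W (Finsupp.sumFinsuppEquivProdFinsupp m).2)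
      (projJ E (inlS E
        (MonoidAlgebra.single (monV E V (Finsupp.sumFinsuppEquivProdFinsupp m).1) 1)))

theorem polyToU_monomial (a : V →₀ ℕ) (e : W →₀ ℕ) (b : Y.ring) :
    polyToU E V W (MvPolynomial.monomial (Finsupp.sumElim a e) b) =
      IdealBaseChange.tmul (toA E) (J E) (RingPushout.inr _ _ b * monW E W e)
        (projJ E (inlS E (MonoidAlgebra.single (monV E V a) 1))) := by
  have h : MvPolynomial.monomial (Finsupp.sumElim a e) b =
      b • MvPolynomial.basisMonomials (V ⊕ W) Y.ring (Finsupp.sumElim a e) := by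
    rw [MvPolynomial.coe_basisMonomials, MvPolynomial.smul_monomial, smul_eq_mul, mul_one]
  have h' : Finsupp.sumFinsuppEquivProdFinsupp (Finsupp.sumElim a e) = (a, e) :=
    Finsupp.sumFinsuppEquivProdFinsupp.apply_symm_apply (a, e)
  rw [h, map_smul, polyToU, Module.Basis.constr_basis, h', U_smul_def, IdealBaseChange.smul_tmul]

/-- On an element `b w s`, with `s` in `ℤ[P] ⊗_{ℤ[Q]} ℤ[N]`, the left inverse of `α` takes the value
`b w ⊗ (s - s')`, where `s'` is the image of `s` in `ℤ[N]`. By additivity it is enough to treat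
`s = q v n` with `q ∈ Q`, `n ∈ N` and `v` a monomial in `V`, and there `q` passes to `N`. -/
theorem polyToU_polyOfA_mul
    (hV : Function.Surjective fun a : X.mon × (V →₀ ℕ) => E.ι.mon a.1 * monV E V a.2)
    (b : Y.ring) (e : W →₀ ℕ) (s : S E) :
    polyToU E V W (polyOfA E V W hW (RingPushout.inr _ _ b * monW E W e * toA E s)) =
      IdealBaseChange.tmul (toA E) (J E) (RingPushout.inr _ _ b * monW E W e) (projJ E s) := by
  let c : A E := RingPushout.inr _ _ b * monW E W e
  let F : S E →+ U E := (polyToU E V W).toAddMonoidHom.comp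
    (((polyOfA E V W hW) : A E →+ _).comp ((AddMonoidHom.mulLeft c).comp (toA E : S E →+ A E)))
  let F' : S E →+ U E :=
    { toFun := fun s => IdealBaseChange.tmul (toA E) (J E) c (projJ E s)
      map_zero' := by
        have h := IdealBaseChange.tmul_add (f := toA E) c (0 : J E) 0
        rw [add_zero, left_eq_add] at h
        rw [map_zero, h]
      map_add' := fun s t => by rw [map_add, IdealBaseChange.tmul_add] }
  refine DFunLike.congr_fun (f := F) (g := F') (S_addHom_ext E fun p n => ?_) s
  obtain ⟨⟨q, a⟩, rfl⟩ := hV p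
  let v : S E := inlS E (MonoidAlgebra.single (monV E V a) 1)
  let n' : MonoidAlgebra ℤ Y.mon := MonoidAlgebra.single (φ.mon q * n) 1
  have hs : (inlS E (MonoidAlgebra.single (E.ι.mon q * monV E V a) 1) *
      inrS E (MonoidAlgebra.single n 1) : S E) = inrS E n' * v := by
    have h₁ : (MonoidAlgebra.single (E.ι.mon q * monV E V a) 1 : MonoidAlgebra ℤ E.mid.mon) =
        MonoidAlgebra.single (E.ι.mon q) 1 * MonoidAlgebra.single (monV E V a) 1 := by
      rw [MonoidAlgebra.single_mul_single, one_mul]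
    have h₂ : n' = MonoidAlgebra.single (φ.mon q) 1 * MonoidAlgebra.single n 1 := by
      rw [MonoidAlgebra.single_mul_single, one_mul]
    rw [h₁, h₂, map_mul, map_mul, inlS_ι]
    ring
  have hn : toA E (inrS E n') = RingPushout.inr _ _ (Y.α (φ.mon q * n)) :=
    toA_inrS E _
  change F _ = F' _
  rw [hs]
  change polyToU E V W (polyOfA E V W hW (c * toA E (inrS E n' * v))) =
    IdealBaseChange.tmul (toA E) (J E) c (projJ E (inrS E n' * v))
  have h₁ : c * toA E (inrS E n' * v) = polyToA E V W
      (MvPolynomial.monomial (Finsupp.sumElim a e) (Y.α (φ.mon q * n) * b)) := by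
    rw [polyToA_monomial, map_mul, hn, map_mul (RingPushout.inr _ _)]
    change c * (_ * toA E v) = _ * _ * _ * toA E v
    ring
  rw [h₁, polyOfA_polyToA, polyToU_monomial, projJ_inr_mul, IdealBaseChange.tmul_smul, hn,
    IdealBaseChange.smul_tmul, map_mul, mul_assoc]

include hW in
/-- The map `α : U → I` is injective: sending a monomial `b v w` of `R ⊗_C B = B[V ⊔ W]` to
`b w ⊗ (v - v')`, where `v'` is the image of `v` in `N`, gives a left inverse. -/
theorem alpha_injective
    (hV : Function.Surjective fun a : X.mon × (V →₀ ℕ) => E.ι.mon a.1 * monV E V a.2) :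
    Function.Injective (alpha E) := by
  refine Function.LeftInverse.injective
    (g := fun x : I E => polyToU E V W (polyOfA E V W hW (x : A E))) fun x => ?_
  induction x using IdealBaseChange.induction_on with
  | zero => simp
  | add x y hx hy =>
    simp only [map_add, Submodule.coe_add] at hx hy ⊢
    rw [hx, hy]
  | tmul a j =>
    change polyToU E V W (polyOfA E V W hW (a * toA E j)) = _
    obtain ⟨f, rfl⟩ := polyToA_surjective E V W hW a
    induction f using MvPolynomial.induction_on' with
    | monomial m b =>
      obtain ⟨⟨a, e⟩, rfl⟩ := Finsupp.sumFinsuppEquivProdFinsupp.symm.surjective m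
      change polyToU E V W (polyOfA E V W hW
        (polyToA E V W (MvPolynomial.monomial (Finsupp.sumElim a e) b) * toA E j)) =
        IdealBaseChange.tmul (toA E) (J E)
          (polyToA E V W (MvPolynomial.monomial (Finsupp.sumElim a e) b)) j
      rw [polyToA_monomial, mul_assoc, ← map_mul, polyToU_polyOfA_mul E V W hW hV, projJ_mul,
        IdealBaseChange.tmul_smul, IdealBaseChange.smul_tmul, mul_comm]
    | add f g hf hg =>
      have h (x y : A E) (j : J E) : IdealBaseChange.tmul (toA E) (J E) (x + y) j =
          IdealBaseChange.tmul (toA E) (J E) x j + IdealBaseChange.tmul (toA E) (J E) y j := by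
        let := (toA E).toAlgebra
        exact TensorProduct.add_tmul x y j
      rw [map_add, add_mul, map_add, map_add, hf, hg, h]

end Injectivity

end LogSquare

/-! ### The long exact sequence -/

section LongExactSequence
open AlgebraicTopology

/-- Replacing the middle term of an exact sequence by an isomorphic module. -/
theorem function_exact_comp_iso {R : Type w} [Ring R] {M₁ M₂ M₂' M₃ : ModuleCat.{u} R}
    {f : M₁ ⟶ M₂} {g : M₂ ⟶ M₃} (h : Function.Exact f.hom g.hom) (e : M₂ ≅ M₂') :
    Function.Exact (f ≫ e.hom).hom (e.inv ≫ g).hom := fun y => by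
  have hy : e.hom (e.inv y) = y := by simp
  refine (h (e.inv y)).trans ⟨fun ⟨x, hx⟩ => ⟨x, ?_⟩, fun ⟨x, hx⟩ => ⟨x, ?_⟩⟩
  · exact (congrArg e.hom hx).trans hy
  · rw [← hx]
    exact (e.hom_inv_id_apply (f x)).symm

theorem function_exact_iso_inv_comp {R : Type w} [Ring R] {M₁ M₁' M₂ M₃ : ModuleCat.{u} R}
    {f : M₁ ⟶ M₂} {g : M₂ ⟶ M₃} (h : Function.Exact f.hom g.hom) (e : M₁ ≅ M₁') :
    Function.Exact (e.inv ≫ f).hom g.hom := fun y =>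
  (h y).trans ⟨fun ⟨x, hx⟩ => ⟨e.hom x, (congrArg f (e.hom_inv_id_apply x)).trans hx⟩,
    fun ⟨x, hx⟩ => ⟨e.inv x, hx⟩⟩

theorem function_exact_comp_iso_hom {R : Type w} [Ring R] {M₁ M₂ M₃ M₃' : ModuleCat.{u} R}
    {f : M₁ ⟶ M₂} {g : M₂ ⟶ M₃} (h : Function.Exact f.hom g.hom) (e : M₃ ≅ M₃') :
    Function.Exact f.hom (g ≫ e.hom).hom := fun y =>
  ⟨fun hy => (h y).1 ((e.hom_inv_id_apply (g y)).symm.trans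
    ((congrArg e.inv hy).trans (map_zero e.inv.hom))),
    fun hy => (congrArg e.hom ((h y).2 hy)).trans (map_zero e.hom.hom)⟩

theorem shortExact_alternatingFaceMapComplex {A : Type*} [Category* A] [Abelian A]
    {S : ShortComplex (SimplicialObject A)} (h : S.ShortExact) :
    (S.map (alternatingFaceMapComplex A)).ShortExact := by
  refine HomologicalComplex.shortExact_of_degreewise_shortExact _ fun n => ?_
  exact h.map_of_exact ((evaluation _ A).obj (Opposite.op ⦋n⦌))

variable {B : Type u} [CommRing B] {S : ShortComplex (SimplicialObject (ModuleCat.{u} B))}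
  (h : S.ShortExact)

/-- The connecting homomorphism of the homology of simplicial modules. -/
noncomputable def simplicialConnecting (n : ℕ) :
    (simplicialHomology B (n + 1)).obj S.X₃ ⟶ (simplicialHomology B n).obj S.X₁ :=
  (shortExact_alternatingFaceMapComplex h).δ (n + 1) n (by simp)

include h in
theorem simplicialHomology_exact_middle (n : ℕ) :
    Function.Exact ((simplicialHomology B n).map S.f).hom ((simplicialHomology B n).map S.g).hom :=
  (ShortComplex.ShortExact.moduleCat_exact_iff_function_exact _).1
    ((shortExact_alternatingFaceMapComplex h).homology_exact₂ n)

theorem simplicialHomology_exact_right (n : ℕ) :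
    Function.Exact ((simplicialHomology B (n + 1)).map S.g).hom (simplicialConnecting h n).hom :=
  (ShortComplex.ShortExact.moduleCat_exact_iff_function_exact _).1
    ((shortExact_alternatingFaceMapComplex h).homology_exact₃ (n + 1) n (by simp))

theorem simplicialHomology_exact_left (n : ℕ) :
    Function.Exact (simplicialConnecting h n).hom ((simplicialHomology B n).map S.f).hom :=
  (ShortComplex.ShortExact.moduleCat_exact_iff_function_exact _).1
    ((shortExact_alternatingFaceMapComplex h).homology_exact₁ (n + 1) n (by simp))

/-- For a pushout square `D` of a monomorphism `f` and a morphism `g`, the sequence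
`0 → A → B ⊞ C → D → 0` given by `(f, g)` and by the difference of the maps to `D`. -/
theorem CategoryTheory.IsPushout.shortExact_sub {A : Type*} [Category* A] [Abelian A] {X₁ X₂ X₃ X₄ : A}
    {t : X₁ ⟶ X₂} {l : X₁ ⟶ X₃} {r : X₂ ⟶ X₄} {b : X₃ ⟶ X₄} (h : IsPushout t l r b) [Mono t] :
    (ShortComplex.mk (biprod.lift t l) (biprod.desc r (-b)) (by simp [h.w])).ShortExact := by
  have h' : IsPushout t (-l) r (-b) :=
    IsPushout.of_iso h (Iso.refl _) (Iso.refl _) (-Iso.refl _) (Iso.refl _)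
      (by simp) (by simp) (by simp) (by simp)
  let S := ShortComplex.mk (biprod.lift t l) (biprod.desc r (-b)) (by simp [h.w])
  let e : h'.shortComplex ≅ S :=
    ShortComplex.isoMk (Iso.refl _) (Iso.refl _) (Iso.refl _)
      (by
        refine (Category.id_comp _).trans (Eq.trans ?_ (Category.comp_id _).symm)
        change biprod.lift t l = biprod.lift t (-(-l))
        rw [neg_neg])
      ((Category.id_comp _).trans (Category.comp_id _).symm)
  have : Mono S.f := mono_of_mono_fac (biprod.lift_fst t l)
  have : Epi S.g := h'.epi_shortComplex_g
  exact ⟨(ShortComplex.exact_iff_of_iso e).1 h'.exact_shortComplex⟩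

variable {A A' : Type*} [Category* A] [Category* A'] [Preadditive A] [Preadditive A']
  [HasBinaryBiproducts A] [HasBinaryBiproducts A'] (H : A ⥤ A') [H.Additive]
  [PreservesBinaryBiproducts H] {M K L : A} {K' L' : A'}

theorem map_biprod_lift_mapIso (f : M ⟶ K) (g : M ⟶ L) (e : H.obj K ≅ K') (e' : H.obj L ≅ L') :
    H.map (biprod.lift f g) ≫ (H.mapBiprod K L ≪≫ biprod.mapIso e e').hom =
      biprod.lift (H.map f ≫ e.hom) (H.map g ≫ e'.hom) := by
  rw [Iso.trans_hom, ← Category.assoc, biprod.map_lift_mapBiprod]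
  exact biprod.hom_ext _ _ (by simp) (by simp)

theorem mapIso_inv_map_biprod_desc_neg (f : K ⟶ M) (g : L ⟶ M) (e : H.obj K ≅ K')
    (e' : H.obj L ≅ L') :
    (H.mapBiprod K L ≪≫ biprod.mapIso e e').inv ≫ H.map (biprod.desc f (-g)) =
      biprod.desc (e.inv ≫ H.map f) (-(e'.inv ≫ H.map g)) := by
  rw [Iso.trans_inv, Category.assoc, biprod.mapBiprod_inv_map_desc]
  exact biprod.hom_ext' _ _ (by simp) (by simp)

end LongExactSequence

namespace LogSquare

variable {X Y : PrelogRing.{u}} {φ : X ⟶ Y} (E : Factorisation φ)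

/-- If `P = Q` then `U = 0`, since `ℤ[P] ⊗_{ℤ[Q]} ℤ[N] = ℤ[N]`. -/
theorem subsingleton_U (h : Function.Surjective E.ι.mon) : Subsingleton (U E) := by
  have h₀ : projJ E = 0 := by
    refine S_addHom_ext E fun p n => ?_
    obtain ⟨q, rfl⟩ := h p
    rw [inlS_ι, ← map_mul]
    exact Subtype.ext (by
      change inrS E _ - inrS E (augS E (inrS E _)) = 0
      rw [augS_inrS, sub_self])
  have hj (j : J E) : j = 0 := by
    have e := projJ_mul E 1 j
    rw [one_mul, one_smul, h₀] at e
    exact e.symm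
  have hx (x : U E) : x = 0 := by
    induction x using IdealBaseChange.induction_on with
    | zero => rfl
    | add x y hx hy => rw [hx, hy, add_zero]
    | tmul a j =>
      rw [hj j]
      let := (toA E).toAlgebra
      exact TensorProduct.tmul_zero _ a
  exact ⟨fun x y => (hx x).trans (hx y).symm⟩

end LogSquare

section Main
open AlgebraicTopology LogSquare

variable {X Y : PrelogRing.{u}} {φ : X ⟶ Y} {Z : SimplicialObject PrelogRing.{u}}
    {i : (SimplicialObject.const PrelogRing.{u}).obj X ⟶ Z}
    {p : Z ⟶ (SimplicialObject.const PrelogRing.{u}).obj Y}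
    (fac : i ≫ p = (SimplicialObject.const PrelogRing.{u}).map φ)

theorem mono_simplicialAlpha (hi : IsFreeCofibration i) :
    Mono (simplicialAlpha (simplicialFactorisation i p fac)) := by
  obtain ⟨V, W, hV, hW, -⟩ := hi
  have h (n : SimplexCategoryᵒᵖ) :
      Mono ((simplicialAlpha (simplicialFactorisation i p fac)).app n) :=
    (ModuleCat.mono_iff_injective _).2 (alpha_injective
      ((simplicialFactorisation i p fac).obj n) (V n.unop.len) (W n.unop.len)
      (hW n.unop.len) (hV n.unop.len).2)
  exact NatTrans.mono_of_mono_app _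

theorem isZero_simplicialHomology_zero {B : Type u} [CommRing B]
    (M : SimplicialObject (ModuleCat.{u} B)) (h : Subsingleton (M _⦋0⦌)) :
    IsZero ((simplicialHomology B 0).obj M) := by
  have h₀ : ((alternatingFaceMapComplex _).obj M).ExactAt 0 :=
    ShortComplex.exact_of_isZero_X₂ _ (ModuleCat.isZero_of_subsingleton (M _⦋0⦌))
  exact h₀.isZero_homology

theorem isZero_homologyU_zero (hi₀ : IsIso (i.app (Opposite.op ⦋0⦌))) :
    IsZero ((simplicialHomology Y.ring 0).obj (simplicialU (simplicialFactorisation i p fac))) :=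
  isZero_simplicialHomology_zero _ (subsingleton_U
    ((simplicialFactorisation i p fac).obj (Opposite.op ⦋0⦌))
    fun a => ⟨degZeroInv hi₀ a, ι_degZeroInv hi₀ a⟩)
end Main
theorem proposition4p18 {X Y : PrelogRing.{u}} (φ : X ⟶ Y)
    (hring : Function.Surjective φ.ring) (hmon : Function.Surjective φ.mon)
    (Z : SimplicialObject PrelogRing.{u})
    (i : (SimplicialObject.const PrelogRing.{u}).obj X ⟶ Z)
    (p : Z ⟶ (SimplicialObject.const PrelogRing.{u}).obj Y)
    (fac : i ≫ p = (SimplicialObject.const PrelogRing.{u}).map φ)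
    (hi : IsFreeCofibration i) (hp : IsTrivialFibration p)
    (hi₀ : IsIso (i.app (Opposite.op ⦋0⦌))) :
    ∃ (a : ∀ n : ℕ,
        (simplicialHomology Y.ring (n + 1)).obj (simplicialU (simplicialFactorisation i p fac)) ⟶
          torSelf φ.ring (n + 1) ⊞ termW Y.ring φ.mon (n + 1))
      (b : ∀ n : ℕ,
        torSelf φ.ring (n + 1) ⊞ termW Y.ring φ.mon (n + 1) ⟶
          (simplicialHomology Y.ring (n + 1)).obj (simplicialD (simplicialFactorisation i p fac)))
      (δ : ∀ n : ℕ,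
        (simplicialHomology Y.ring (n + 2)).obj (simplicialD (simplicialFactorisation i p fac)) ⟶
          (simplicialHomology Y.ring (n + 1)).obj (simplicialU (simplicialFactorisation i p fac))),
      (∀ n, Function.Exact (a n).hom (b n).hom) ∧
      (∀ n, Function.Exact (b (n + 1)).hom (δ n).hom) ∧
      (∀ n, Function.Exact (δ n).hom (a n).hom) ∧
      Function.Surjective (b 0).hom ∧
      ∃ (e : ∀ n : ℕ,
          (simplicialHomology Y.ring (n + 1)).obj (simplicialI (simplicialFactorisation i p fac)) ≅
            torSelf φ.ring (n + 1))
        (e' : ∀ n : ℕ,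
          (simplicialHomology Y.ring (n + 1)).obj (simplicialBT (simplicialFactorisation i p fac)) ≅
            termW Y.ring φ.mon (n + 1)),
        ∀ n,
          a n = biprod.lift
            ((simplicialHomology Y.ring (n + 1)).map
              (simplicialAlpha (simplicialFactorisation i p fac)) ≫ (e n).hom)
            ((simplicialHomology Y.ring (n + 1)).map
              (simplicialBeta (simplicialFactorisation i p fac)) ≫ (e' n).hom) ∧
          b n = biprod.desc
            ((e n).inv ≫ (simplicialHomology Y.ring (n + 1)).map
              (fromI (simplicialFactorisation i p fac)))
            (-((e' n).inv ≫ (simplicialHomology Y.ring (n + 1)).map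
              (fromBT (simplicialFactorisation i p fac)))) := by
  let F := simplicialFactorisation i p fac
  have := mono_simplicialAlpha fac hi
  have sq : IsPushout (simplicialAlpha F) (simplicialBeta F) (fromI F) (fromBT F) :=
    IsPushout.of_hasPushout _ _
  have hS := sq.shortExact_sub
  have (n : ℕ) : PreservesBinaryBiproducts (simplicialHomology Y.ring n) :=
    preservesBinaryBiproducts_of_preservesBiproducts _
  let e := homologyIIso fac hring hi hp
  let e' := homologyBTIso fac hmon hi hp hi₀
  let Φ (n : ℕ) : (simplicialHomology Y.ring (n + 1)).obj (simplicialI F ⊞ simplicialBT F) ≅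
      torSelf φ.ring (n + 1) ⊞ termW Y.ring φ.mon (n + 1) :=
    (simplicialHomology Y.ring (n + 1)).mapBiprod _ _ ≪≫ biprod.mapIso (e n) (e' n)
  refine ⟨fun n => (simplicialHomology Y.ring (n + 1)).map
      (biprod.lift (simplicialAlpha F) (simplicialBeta F)) ≫ (Φ n).hom,
    fun n => (Φ n).inv ≫ (simplicialHomology Y.ring (n + 1)).map
      (biprod.desc (fromI F) (-fromBT F)),
    fun n => simplicialConnecting hS (n + 1),
    fun n => function_exact_comp_iso (simplicialHomology_exact_middle hS (n + 1)) (Φ n),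
    fun n => function_exact_iso_inv_comp (simplicialHomology_exact_right hS (n + 1)) (Φ (n + 1)),
    fun n => function_exact_comp_iso_hom (simplicialHomology_exact_left hS (n + 1)) (Φ n),
    fun y => ?_, e, e', fun n => ⟨?_, ?_⟩⟩
  · refine (function_exact_iso_inv_comp (simplicialHomology_exact_right hS 0) (Φ 0) y).1 ?_
    have h := (isZero_homologyU_zero fac hi₀).eq_of_tgt (simplicialConnecting hS 0) 0
    rw [h]
    rfl
  · exact map_biprod_lift_mapIso _ _ _ (e n) (e' n)
  · exact mapIso_inv_map_biprod_desc_neg _ _ _ (e n) (e' n)
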